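/- Let $M=(E,r)$ be a matroid on a finite set. For a bijection $\sigma:E\to\{1,\dots,|E|\}$ (an ordering of $E$) put $\mathrm{cost}(\sigma)=\sum_{i=1}^{|E|} r(\{e\in E:\sigma(e)\le i\})$. Matroid MLOP asks for an ordering of minimum cost (an optimal ordering), and, in decision form, whether some ordering has cost at most a given natural number $k$. Graphic matroid MLOP on a finite simple graph $G$ is this problem for the graphic matroid $M[G]$, whose elements are the edges of $G$ and whose independent sets are the acyclic edge sets. A block of $G$ is a maximal connected subgraph without a cut vertex. A cactus graph is a graph in which every block is a single edge or a cycle (or an isolated vertex); it need not be connected. For a basis $B$ of $M$ (for $M[G]$: a spanning forest, that is, a maximal acyclic edge set) and $e\in E\setminus B$, let $C(B,e)$ be the fundamental circuit of $e$. For an ordering $\pi:B\to\{1,\dots,|B|\}$ of $B$ put $\max C(B,e)_\pi=\max\{\pi(e'):e'\in C(B,e)\setminus\{e\}\}$. An ordering $\sigma$ of $E$ extends $\pi$ if it orders $B$ in the same way as $\pi$ and places each $e\in E\setminus B$ after the element of $B$ in position $\max C(B,e)_\pi$ of $\pi$ and before the next element of $B$ (if there is one). **Theorem.** (1) Graphic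 matroid MLOP on simple cactus graphs is solvable in polynomial time. That is, there is one algorithm (a random access machine program with addition, truncated subtraction, comparison and indirect addressing, each at unit cost) which, given a simple cactus graph $G$ with $n$ vertices and $m$ edges as a list of its edges, and $k\in\mathbb N$, halts after at most $q(n+m)$ steps, for a fixed polynomial $q$, and outputs an optimal ordering of the edges for $M[G]$, its cost, and whether there is an ordering of cost at most $k$. (2) Let $G$ be a finite simple cactus graph. (a) In every optimal ordering for $M[G]$, all bridges of $G$ come after all other edges. (b) Let $T$ be any spanning forest of $G$. Call an ordering $\pi$ of $T$ greedy if the blocks of $G$ that are cycles can be listed as $B_1,\dots,B_c$ with $|E(B_1)|\le\dots\le|E(B_c)|$ such that, in $\pi$, every edge of $T$ in $B_i$ comes before every edge of $T$ in $B_j$ whenever $i<j$, and the bridges come after all other edges of $T$. Then $T$ has a greedy ordering. Every greedy ordering $\pi$ of $T$ attains $$\min_{B}\ \min_{\pi'}\ \sum_{e\in E(G)\setminus B}\max C(B,e)_{\pi'},$$ where $B$ ranges over all spanning forests of $G$ and $\pi'$ over all orderings of $B$. Moreover, some ordering of $E(G)$ extends $\pi$, and every ordering of $E(G)$ that extends $\pi$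 is optimal for $M[G]$. -/

import Mathlib

/-! ### Linear orderings of a matroid -/

/-- `σ` orders the finite set `S`: it restricts to a bijection `S → {1, …, |S|}`
(its values outside `S` are irrelevant). -/
def IsOrdering {α : Type*} (S : Set α) (σ : α → ℕ) : Prop :=
  Set.BijOn σ S (Set.Icc 1 S.ncard)

/-- The objective `∑_{i=1}^{|E|} r({e ∈ E | σ e ≤ i})` of an ordering of the ground set. -/
noncomputable def mlopCost {α : Type*} (M : Matroid α) (σ : α → ℕ) : ℕ :=
  ∑ i ∈ Finset.Icc 1 M.E.ncard, (M.eRk {e ∈ M.E | σ e ≤ i}).toNat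

/-- `σ` is an optimal solution of matroid MLOP on `M`. -/
def IsOptimalOrdering {α : Type*} (M : Matroid α) (σ : α → ℕ) : Prop :=
  IsOrdering M.E σ ∧ ∀ τ : α → ℕ, IsOrdering M.E τ → mlopCost M σ ≤ mlopCost M τ

/-- `max C(B, e)_π`: the last position, in the ordering `π` of the basis `B`, of an element
of the fundamental circuit of `e` other than `e` itself. -/
noncomputable def circuitMax {α : Type*} (M : Matroid α) (B : Set α) (π : α → ℕ) (e : α) : ℕ :=
  sSup (π '' (M.fundCircuit e B \ {e}))

/-- The objective `∑_{e ∈ E - B} max C(B, e)_π` of an ordering `π` of a basis `B`. -/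
noncomputable def basisCost {α : Type*} (M : Matroid α) (B : Set α) (π : α → ℕ) : ℕ :=
  ∑ᶠ e ∈ M.E \ B, circuitMax M B π e

/-- The ordering `σ` of the ground set extends the ordering `π` of the basis `B`: it orders `B`
as `π` does, and puts each `e ∉ B` after the basis element in position `max C(B, e)_π`
and before the next basis element. -/
structure ExtendsBasisOrdering {α : Type*} (M : Matroid α) (B : Set α) (π σ : α → ℕ) :
    Prop where
  isOrdering : IsOrdering M.E σ
  basis_lt : ∀ b ∈ B, ∀ b' ∈ B, σ b < σ b' ↔ π b < π b'
  after : ∀ b ∈ B, ∀ e ∈ M.E \ B, π b ≤ circuitMax M B π e → σ b < σ e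
  before : ∀ b ∈ B, ∀ e ∈ M.E \ B, circuitMax M B π e < π b → σ e < σ b

/-! ### The graphic matroid -/

/-- The exchange property of forests. -/
theorem forest_exchange {V : Type*} [Finite V] {I J : Set (Sym2 V)}
    (hId : ∀ e ∈ I, ¬ e.IsDiag) (hJd : ∀ e ∈ J, ¬ e.IsDiag)
    (hI : (SimpleGraph.fromEdgeSet I).IsAcyclic) (hJ : (SimpleGraph.fromEdgeSet J).IsAcyclic)
    (hcard : I.ncard < J.ncard) :
    ∃ e ∈ J, e ∉ I ∧ (SimpleGraph.fromEdgeSet (insert e I)).IsAcyclic := by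
  by_contra hcon
  push Not at hcon
  have hes : ∀ {F : Set (Sym2 V)}, (∀ e ∈ F, ¬ e.IsDiag) →
      (SimpleGraph.fromEdgeSet F).edgeSet = F := by
    intro F hF
    rw [SimpleGraph.edgeSet_fromEdgeSet]
    ext e
    simp only [Set.mem_sdiff]
    exact ⟨fun h => h.1, fun h => ⟨h, fun h' => hF e h (by simpa using h')⟩⟩
  have hreach : ∀ x y, s(x, y) ∈ J → (SimpleGraph.fromEdgeSet I).Reachable x y := by
    intro x y hxy
    have hne : x ≠ y := by simpa using hJd _ hxy
    by_cases hm : s(x, y) ∈ I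
    · exact SimpleGraph.Adj.reachable (by simp [hm, hne])
    · by_contra hn
      refine hcon _ hxy hm ?_
      have := hI.sup_edge_of_not_reachable hn
      convert this using 1
      rw [SimpleGraph.edge, ← SimpleGraph.fromEdgeSet_union, Set.union_comm, Set.singleton_union]
  have hne : Nonempty V := by
    obtain ⟨e, -⟩ : J.Nonempty := Set.nonempty_of_ncard_ne_zero (by omega)
    exact ⟨e.out.1⟩
  obtain ⟨T, hJT, -, hT⟩ :=
    (SimpleGraph.connected_top (V := V)).exists_isTree_le_of_le_of_isAcyclic le_top hJ
  have hTc := (SimpleGraph.isTree_iff_connected_and_card.1 hT).2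
  have hJsub : J ⊆ T.edgeSet := by
    rw [← hes hJd]; exact SimpleGraph.edgeSet_mono hJT
  set K := SimpleGraph.fromEdgeSet (I ∪ (T.edgeSet \ J)) with hK
  have hIK : SimpleGraph.fromEdgeSet I ≤ K := SimpleGraph.fromEdgeSet_mono Set.subset_union_left
  have hKconn : K.Connected := by
    refine ⟨fun x y => ?_⟩
    obtain ⟨p⟩ := hT.connected.preconnected x y
    induction p with
    | nil => exact SimpleGraph.Reachable.refl _
    | cons h p ih =>
      refine SimpleGraph.Reachable.trans ?_ ih
      rename_i a b c
      by_cases hm : s(a, b) ∈ J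
      · exact (hreach _ _ hm).mono hIK
      · refine SimpleGraph.Adj.reachable ?_
        rw [hK, SimpleGraph.fromEdgeSet_adj]
        exact ⟨Or.inr ⟨h, hm⟩, h.ne⟩
  have h1 := hKconn.card_vert_le_card_edgeSet_add_one
  have hKe : K.edgeSet = I ∪ (T.edgeSet \ J) := hes (by
    rintro e (he | he)
    · exact hId e he
    · exact T.not_isDiag_of_mem_edgeSet he.1)
  have h2 : Nat.card K.edgeSet ≤ I.ncard + (T.edgeSet \ J).ncard := by
    rw [hKe]; exact Set.ncard_union_le _ _
  have h3 : (T.edgeSet \ J).ncard + J.ncard = Nat.card T.edgeSet :=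
    Set.ncard_sdiff_add_ncard_of_subset hJsub
  omega

/-- The graphic matroid `M[G]`: its elements are the edges of `G`, and a set of edges is
independent if it is acyclic. -/
noncomputable def graphicMatroid {V : Type*} [Finite V] (G : SimpleGraph V) :
    Matroid (Sym2 V) :=
  (IndepMatroid.ofFinite (E := G.edgeSet) (Set.toFinite _)
    (fun F => F ⊆ G.edgeSet ∧ (SimpleGraph.fromEdgeSet F).IsAcyclic)
    ⟨Set.empty_subset _, by simp⟩
    (fun _ _ hJ hIJ => ⟨hIJ.trans hJ.1, hJ.2.anti (SimpleGraph.fromEdgeSet_mono hIJ)⟩)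
    (fun I J hI hJ hcard => by
      obtain ⟨e, he, heI, hacyc⟩ := forest_exchange
        (fun e he => G.not_isDiag_of_mem_edgeSet (hI.1 he))
        (fun e he => G.not_isDiag_of_mem_edgeSet (hJ.1 he)) hI.2 hJ.2 hcard
      exact ⟨e, he, heI, Set.insert_subset (hJ.1 he) hI.1, hacyc⟩)
    (fun _ hI => hI.1)).matroid

/-! ### Cactus graphs -/

/-- `H` has no cut vertex: deleting any one vertex of `H` does not disconnect it. -/
def HasNoCutVertex {V : Type*} {G : SimpleGraph V} (H : G.Subgraph) : Prop :=
  ∀ v ∈ H.verts, (H.deleteVerts {v}).Preconnected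

/-- A block is a maximal connected subgraph without a cut vertex. -/
def IsBlock {V : Type*} {G : SimpleGraph V} (H : G.Subgraph) : Prop :=
  Maximal (fun H' : G.Subgraph => H'.Connected ∧ HasNoCutVertex H') H

/-- `H` is a cycle of `G`, as a subgraph. -/
def IsCycleSubgraph {V : Type*} {G : SimpleGraph V} (H : G.Subgraph) : Prop :=
  ∃ (v : V) (c : G.Walk v v), c.IsCycle ∧ H = c.toSubgraph

/-- A cactus graph: each block is a single edge or a cycle (or an isolated vertex). The graph
need not be connected. -/
def IsCactus {V : Type*} (G : SimpleGraph V) : Prop :=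
  ∀ H : G.Subgraph, IsBlock H →
    (∃ v, H = G.singletonSubgraph v) ∨ (∃ (u v : V) (h : G.Adj u v), H = G.subgraphOfAdj h) ∨
      IsCycleSubgraph H

/-- The greedy orderings `π` of the edges of a spanning forest `T`: the blocks of `G` that are
cycles are listed as `B 0, …, B (c - 1)` in order of non-decreasing length, the edges of `T` in an
earlier block come before those in a later block, and the bridges come last. -/
structure IsGreedyOrdering {V : Type*} (G : SimpleGraph V) (T : Set (Sym2 V))
    (π : Sym2 V → ℕ) : Prop where
  isOrdering : IsOrdering T π
  bridges_last : ∀ e ∈ T, ∀ f ∈ T, ¬ G.IsBridge e → G.IsBridge f → π e < π f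
  blocks : ∃ (c : ℕ) (B : Fin c → G.Subgraph),
    Function.Injective B ∧ Set.range B = {H | IsBlock H ∧ IsCycleSubgraph H} ∧
    Monotone (fun i => (B i).edgeSet.ncard) ∧
    ∀ i j, i < j → ∀ e ∈ T ∩ (B i).edgeSet, ∀ f ∈ T ∩ (B j).edgeSet, π e < π f

/-! ### A random access machine with a step count

Programs act on finitely many natural-number variables and finitely many arrays of natural
numbers (those that the program mentions). The arithmetic is addition and truncated subtraction,
so that, as is standard, polynomially many steps amount to polynomial time on a Turing machine. -/

/-- Expressions; `lt` and `eq` have value `1` or `0`. -/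
inductive RamExpr : Type
  | const (c : ℕ)
  | var (x : ℕ)
  | arr (a : ℕ) (i : RamExpr)
  | add (e₁ e₂ : RamExpr)
  | sub (e₁ e₂ : RamExpr)
  | lt (e₁ e₂ : RamExpr)
  | eq (e₁ e₂ : RamExpr)

/-- Programs. -/
inductive RamProg : Type
  | skip
  | assign (x : ℕ) (e : RamExpr)
  | store (a : ℕ) (i e : RamExpr)
  | seq (p q : RamProg)
  | ite (b : RamExpr) (p q : RamProg)
  | while (b : RamExpr) (p : RamProg)

/-- Memory: the values of the variables and of the array cells. -/
@[ext] structure RamState : Type where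
  var : ℕ → ℕ
  arr : ℕ → ℕ → ℕ

/-- The value of an expression. -/
def RamExpr.eval (s : RamState) : RamExpr → ℕ
  | .const c => c
  | .var x => s.var x
  | .arr a i => s.arr a (i.eval s)
  | .add e₁ e₂ => e₁.eval s + e₂.eval s
  | .sub e₁ e₂ => e₁.eval s - e₂.eval s
  | .lt e₁ e₂ => if e₁.eval s < e₂.eval s then 1 else 0
  | .eq e₁ e₂ => if e₁.eval s = e₂.eval s then 1 else 0

/-- The number of steps that it takes to evaluate an expression. -/
def RamExpr.cost : RamExpr → ℕ
  | .const _ => 1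
  | .var _ => 1
  | .arr _ i => i.cost + 1
  | .add e₁ e₂ => e₁.cost + e₂.cost + 1
  | .sub e₁ e₂ => e₁.cost + e₂.cost + 1
  | .lt e₁ e₂ => e₁.cost + e₂.cost + 1
  | .eq e₁ e₂ => e₁.cost + e₂.cost + 1

/-- Write a variable. -/
def RamState.setVar (s : RamState) (x v : ℕ) : RamState :=
  ⟨Function.update s.var x v, s.arr⟩

/-- Write an array cell. -/
def RamState.setArr (s : RamState) (a i v : ℕ) : RamState :=
  ⟨s.var, Function.update s.arr a (Function.update (s.arr a) i v)⟩

/-- `RamExec p s s' t`: started in memory `s`, the program `p` halts in memory `s'` after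
exactly `t` steps. -/
inductive RamExec : RamProg → RamState → RamState → ℕ → Prop
  | skip (s : RamState) : RamExec .skip s s 1
  | assign (x : ℕ) (e : RamExpr) (s : RamState) :
      RamExec (.assign x e) s (s.setVar x (e.eval s)) (e.cost + 1)
  | store (a : ℕ) (i e : RamExpr) (s : RamState) :
      RamExec (.store a i e) s (s.setArr a (i.eval s) (e.eval s)) (i.cost + e.cost + 1)
  | seq {p q : RamProg} {s s' s'' : RamState} {t t' : ℕ} :
      RamExec p s s' t → RamExec q s' s'' t' → RamExec (.seq p q) s s'' (t + t')
  | ite_true {b : RamExpr} {p q : RamProg} {s s' : RamState} {t : ℕ} :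
      b.eval s ≠ 0 → RamExec p s s' t → RamExec (.ite b p q) s s' (b.cost + t + 1)
  | ite_false {b : RamExpr} {p q : RamProg} {s s' : RamState} {t : ℕ} :
      b.eval s = 0 → RamExec q s s' t → RamExec (.ite b p q) s s' (b.cost + t + 1)
  | while_true {b : RamExpr} {p : RamProg} {s s' s'' : RamState} {t t' : ℕ} :
      b.eval s ≠ 0 → RamExec p s s' t → RamExec (.while b p) s' s'' t' →
        RamExec (.while b p) s s'' (b.cost + t + t' + 1)
  | while_false {b : RamExpr} {p : RamProg} {s : RamState} :
      b.eval s = 0 → RamExec (.while b p) s s (b.cost + 1)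

/-! ### Input and output of the algorithm -/

/-- `s(u i, v i)`, `i < m`, lists every edge of `G` exactly once. -/
def IsEdgeList {n m : ℕ} (G : SimpleGraph (Fin n)) (u v : Fin m → Fin n) : Prop :=
  Function.Injective (fun i => s(u i, v i)) ∧ Set.range (fun i => s(u i, v i)) = G.edgeSet

/-- The initial memory: variables `0`, `1`, `2` hold the number `n` of vertices, the number `m` of
edges and the threshold `k`; arrays `0` and `1` hold the first and the second endpoints of the
edges; everything else is `0`. -/
def ramInput {n m : ℕ} (u v : Fin m → Fin n) (k : ℕ) : RamState where
  var x := if x = 0 then n else if x = 1 then m else if x = 2 then k else 0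
  arr a i :=
    if h : i < m then
      if a = 0 then (u ⟨i, h⟩ : ℕ) else if a = 1 then (v ⟨i, h⟩ : ℕ) else 0
    else 0

/-- The final memory `s'` solves graphic matroid MLOP on `G` with threshold `k`: array `2` holds
an optimal ordering (cell `i` is the position of the `i`-th edge of the list), variable `3` its
cost, and variable `4` the answer `1` or `0` to the question whether some ordering has cost at
most `k`. -/
def SolvesMlop {n m : ℕ} (G : SimpleGraph (Fin n)) (u v : Fin m → Fin n) (k : ℕ)
    (s' : RamState) : Prop :=
  (∃ σ : Sym2 (Fin n) → ℕ, IsOptimalOrdering (graphicMatroid G) σ ∧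
    (∀ i : Fin m, s'.arr 2 i = σ s(u i, v i)) ∧ s'.var 3 = mlopCost (graphicMatroid G) σ) ∧
  ((∃ τ, IsOrdering (graphicMatroid G).E τ ∧ mlopCost (graphicMatroid G) τ ≤ k) →
    s'.var 4 = 1) ∧
  ((¬ ∃ τ, IsOrdering (graphicMatroid G).E τ ∧ mlopCost (graphicMatroid G) τ ≤ k) →
    s'.var 4 = 0)

/-!
The circuits of the graphic matroid of a cactus graph are the edge sets of the blocks that are
cycles: a cycle is connected and has no cut vertex, so it lies in a block, which the cactus property
forces to be that cycle. Two blocks that share an edge coincide, since their union again is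
connected without a cut vertex. Hence the circuits are pairwise disjoint
(`IsCactus.hasDisjointCircuits`), and everything else about orderings only uses this.

In a matroid with pairwise disjoint circuits the rank of a set is its size minus the number of
circuits contained in it. So the cost of an ordering is a constant minus `∑ (|E| + 1 - t C)`, where
`t C` is the position in which the circuit `C` is completed
(`HasDisjointCircuits.mlopCost_add`), and the task is to minimise the sum of the completion times
of disjoint jobs on one machine. Of two jobs, one has to wait for the other, which costs at least
the smaller of the two processing times; adding this over all pairs gives the lower bound
`pairBound`, which is attained by processing the jobs one after the other, shortest first, without
interruption. Equality in the bound leaves no room for a bridge before the last cycle is completed.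
For a spanning forest the same argument applies with all processing times reduced by one, as a basis
misses exactly one element of each circuit. An ordering that extends a greedy ordering of a
spanning forest again processes the cycles one after the other
(`ExtendsBasisOrdering.isCircuitwise`).

The algorithm determines for each edge `f`, by label propagation, the set of edges `e` whose
deletion, together with that of `f`, separates the ends of `f`. If `f` lies on a cycle, these are
the other edges of the cycle, and if `f` is a bridge, these are all edges. Sorting the edges by the
size of this set, then by the last edge of the set with `f` added, then by `f` itself, is an optimal
ordering. The running time is bounded once and for all for programs all of whose loops are bounded
by the number of vertices or of edges (`LoopProg.exists_ramExec`), so that the correctness proof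
deals with the function `LoopProg.run` on memories only.
-/

/-! ### Completion times of disjoint sets in an ordering -/

/-- Twice the least possible sum of completion times of jobs `i ∈ s` with processing times `ℓ i` on
one machine, written symmetrically: of two distinct jobs one has to wait for the other, and this
costs at least the shorter of the two processing times. -/
def pairBound {ι : Type*} [DecidableEq ι] (s : Finset ι) (ℓ : ι → ℕ) : ℕ :=
  ∑ i ∈ s, ∑ j ∈ s, if i = j then 2 * ℓ i else min (ℓ i) (ℓ j)

theorem two_mul_sum_waiting {ι : Type*} (s : Finset ι) (ℓ t : ι → ℕ) :
    2 * ∑ i ∈ s, ∑ j ∈ s with t j ≤ t i, ℓ j =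
      ∑ i ∈ s, ∑ j ∈ s, ((if t j ≤ t i then ℓ j else 0) + if t i ≤ t j then ℓ i else 0) := by
  simp only [Finset.sum_filter, Finset.sum_add_distrib]
  rw [two_mul]
  congr 1
  exact Finset.sum_comm

theorem pairBound_le {ι : Type*} [DecidableEq ι] {s : Finset ι} {ℓ t : ι → ℕ} :
    pairBound s ℓ ≤ 2 * ∑ i ∈ s, ∑ j ∈ s with t j ≤ t i, ℓ j := by
  rw [two_mul_sum_waiting]
  refine Finset.sum_le_sum fun i _ => Finset.sum_le_sum fun j _ => ?_
  by_cases hij : i = j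
  · subst hij
    simp [two_mul]
  · rw [if_neg hij]
    rcases le_total (t j) (t i) with h | h
    · rw [if_pos h]
      exact (min_le_right _ _).trans (Nat.le_add_right _ _)
    · rw [if_pos h]
      exact (min_le_left _ _).trans (Nat.le_add_left _ _)

theorem two_mul_sum_waiting_le_pairBound {ι : Type*} [DecidableEq ι] {s : Finset ι} {ℓ t : ι → ℕ}
    (hinj : Set.InjOn t s) (hmono : ∀ i ∈ s, ∀ j ∈ s, t i < t j → ℓ i ≤ ℓ j) :
    2 * ∑ i ∈ s, ∑ j ∈ s with t j ≤ t i, ℓ j ≤ pairBound s ℓ := by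
  rw [two_mul_sum_waiting]
  refine Finset.sum_le_sum fun i hi => Finset.sum_le_sum fun j hj => ?_
  by_cases hij : i = j
  · subst hij
    simp [two_mul]
  · rw [if_neg hij]
    rcases lt_or_gt_of_ne (fun h => hij (hinj hi hj h)) with h | h
    · have := hmono i hi j hj h
      rw [if_neg (by omega), if_pos h.le]
      omega
    · have := hmono j hj i hi h
      rw [if_pos h.le, if_neg (by omega)]
      omega

/-- The position of the last element of `X` in the ordering `π`. -/
noncomputable def lastPos {α : Type*} (π : α → ℕ) (X : Set α) : ℕ := sSup (π '' X)

theorem IsOrdering.le_ncard {α : Type*} {S : Set α} {π : α → ℕ}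
    (hπ : IsOrdering S π) {x : α} (hx : x ∈ S) : π x ≤ S.ncard :=
  (hπ.mapsTo hx).2

theorem IsOrdering.one_le {α : Type*} {S : Set α} {π : α → ℕ}
    (hπ : IsOrdering S π) {x : α} (hx : x ∈ S) : 1 ≤ π x :=
  (hπ.mapsTo hx).1

theorem IsOrdering.ncard_setOf_le {α : Type*} {S : Set α} {π : α → ℕ}
    (hπ : IsOrdering S π) {n : ℕ} (hn : n ≤ S.ncard) :
    {x ∈ S | π x ≤ n}.ncard = n := by
  have hinj : Set.InjOn π {x ∈ S | π x ≤ n} := hπ.injOn.mono fun x hx => hx.1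
  have himg : π '' {x ∈ S | π x ≤ n} = Finset.Icc 1 n := by
    ext k
    simp only [Set.mem_image, Set.mem_sep_iff, Finset.coe_Icc, Set.mem_Icc]
    constructor
    · rintro ⟨x, ⟨hx, hxn⟩, rfl⟩
      exact ⟨hπ.one_le hx, hxn⟩
    · rintro ⟨h1, h2⟩
      obtain ⟨x, hx, rfl⟩ := hπ.surjOn ⟨h1, h2.trans hn⟩
      exact ⟨x, ⟨hx, h2⟩, rfl⟩
  rw [← hinj.ncard_image, himg, Set.ncard_coe_finset, Nat.card_Icc, Nat.add_sub_cancel]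

section

variable {α : Type*} [Finite α] {S X Y : Set α} {π : α → ℕ}

theorem le_lastPos {x : α} (hx : x ∈ X) : π x ≤ lastPos π X :=
  le_csSup (Set.toFinite _).bddAbove (Set.mem_image_of_mem _ hx)

theorem exists_eq_lastPos (hX : X.Nonempty) : ∃ x ∈ X, π x = lastPos π X :=
  Nat.sSup_mem (hX.image π) (Set.toFinite _).bddAbove

theorem lastPos_le {n : ℕ} (hX : X.Nonempty) (h : ∀ x ∈ X, π x ≤ n) : lastPos π X ≤ n := by
  obtain ⟨x, hx, hxe⟩ := exists_eq_lastPos (π := π) hX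
  exact hxe ▸ h x hx

theorem IsOrdering.lastPos_le_ncard (hπ : IsOrdering S π) (hX : X ⊆ S) (hne : X.Nonempty) :
    lastPos π X ≤ S.ncard :=
  lastPos_le hne fun _ hx => hπ.le_ncard (hX hx)

theorem IsOrdering.lastPos_ne (hπ : IsOrdering S π) (hX : X ⊆ S) (hY : Y ⊆ S)
    (hXne : X.Nonempty) (hYne : Y.Nonempty) (hXY : Disjoint X Y) : lastPos π X ≠ lastPos π Y := by
  obtain ⟨x, hx, hxe⟩ := exists_eq_lastPos (π := π) hXne
  obtain ⟨y, hy, hye⟩ := exists_eq_lastPos (π := π) hYne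
  intro h
  have : x = y := hπ.injOn (hX hx) (hY hy) (by rw [hxe, hye, h])
  exact Set.disjoint_left.1 hXY hx (this ▸ hy)

theorem ncard_biUnion_finset {ι : Type*} (s : Finset ι) {A : ι → Set α}
    (h : (s : Set ι).PairwiseDisjoint A) : (⋃ i ∈ s, A i).ncard = ∑ i ∈ s, (A i).ncard := by
  have := s.finite_toSet.ncard_biUnion (fun i _ => Set.toFinite (A i)) h
  rw [finsum_mem_coe_finset] at this
  simpa using this

/-- A family of pairwise disjoint nonempty subsets of an ordered set. -/
structure IsDisjointFamily {ι : Type*} (S : Set α) (s : Finset ι) (A : ι → Set α) : Prop where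
  subset : ∀ i ∈ s, A i ⊆ S
  nonempty : ∀ i ∈ s, (A i).Nonempty
  disjoint : (s : Set ι).PairwiseDisjoint A

variable {ι : Type*} {s : Finset ι} {A : ι → Set α}

theorem IsDisjointFamily.injOn_lastPos (hA : IsDisjointFamily S s A) (hπ : IsOrdering S π) :
    Set.InjOn (fun i => lastPos π (A i)) s := by
  intro i hi j hj hij
  by_contra hne
  exact hπ.lastPos_ne (hA.subset i hi) (hA.subset j hj) (hA.nonempty i hi) (hA.nonempty j hj)
    (hA.disjoint hi hj hne) hij

/-- Whatever is finished by the time `A i` is finished fits into that time, and an element outside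
all members of the family that comes earlier takes a further unit of time. -/
theorem IsDisjointFamily.waiting_le (hA : IsDisjointFamily S s A) (hπ : IsOrdering S π)
    {i : ι} (hi : i ∈ s) :
    ∑ j ∈ s with lastPos π (A j) ≤ lastPos π (A i), (A j).ncard ≤ lastPos π (A i) ∧
      ∀ x ∈ S, (∀ j ∈ s, x ∉ A j) → π x ≤ lastPos π (A i) →
        ∑ j ∈ s with lastPos π (A j) ≤ lastPos π (A i), (A j).ncard < lastPos π (A i) := by
  have hle := hπ.lastPos_le_ncard (hA.subset i hi) (hA.nonempty i hi)
  rw [← ncard_biUnion_finset _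
    (hA.disjoint.subset (Finset.coe_subset.2 (Finset.filter_subset _ _)))]
  have hsub : (⋃ j ∈ s.filter fun j => lastPos π (A j) ≤ lastPos π (A i), A j) ⊆
      {x ∈ S | π x ≤ lastPos π (A i)} := by
    intro x hx
    simp only [Finset.mem_filter, Set.mem_iUnion, exists_prop] at hx
    obtain ⟨j, ⟨hj, hji⟩, hxj⟩ := hx
    exact ⟨hA.subset j hj hxj, (le_lastPos hxj).trans hji⟩
  constructor
  · exact (Set.ncard_le_ncard hsub).trans_eq (hπ.ncard_setOf_le hle)
  · intro x hx hxA hxi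
    refine (Set.ncard_lt_ncard (Set.ssubset_iff_of_subset hsub |>.2 ⟨x, ⟨hx, hxi⟩, ?_⟩)).trans_eq
      (hπ.ncard_setOf_le hle)
    simp only [Finset.mem_filter, Set.mem_iUnion, exists_prop, not_exists, not_and]
    exact fun j hj => hxA j hj.1

theorem IsDisjointFamily.pairBound_le [DecidableEq ι] (hA : IsDisjointFamily S s A)
    (hπ : IsOrdering S π) :
    pairBound s (fun i => (A i).ncard) ≤ 2 * ∑ i ∈ s, lastPos π (A i) :=
  (_root_.pairBound_le (t := fun i => lastPos π (A i))).trans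
    (Nat.mul_le_mul_left 2 (Finset.sum_le_sum fun _ hi => (hA.waiting_le hπ hi).1))

/-- In an ordering with least sum of completion times, the elements that belong to no member of the
family come last. -/
theorem IsDisjointFamily.lt_of_sum_le_pairBound [DecidableEq ι] (hA : IsDisjointFamily S s A)
    (hπ : IsOrdering S π)
    (h : 2 * ∑ i ∈ s, lastPos π (A i) ≤ pairBound s (fun i => (A i).ncard)) {i : ι} (hi : i ∈ s)
    {x y : α} (hx : x ∈ A i) (hy : y ∈ S) (hyA : ∀ j ∈ s, y ∉ A j) : π x < π y := by
  by_contra hlt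
  have hstrict := (hA.waiting_le hπ hi).2 y hy hyA ((not_lt.1 hlt).trans (le_lastPos hx))
  have := Finset.sum_lt_sum (fun j hj => (hA.waiting_le hπ hj).1) ⟨i, hi, hstrict⟩
  have := _root_.pairBound_le (s := s) (ℓ := fun i => (A i).ncard) (t := fun i => lastPos π (A i))
  omega

/-- An ordering that runs through the members of the family one after the other, in order of
non-decreasing size and with nothing else in between, has the least sum of completion times. -/
theorem IsDisjointFamily.sum_lastPos_le_pairBound [DecidableEq ι] (hA : IsDisjointFamily S s A)
    (hπ : IsOrdering S π)
    (hpre : ∀ i ∈ s, ∀ x ∈ S, π x ≤ lastPos π (A i) →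
      ∃ j ∈ s, x ∈ A j ∧ lastPos π (A j) ≤ lastPos π (A i))
    (hmono : ∀ i ∈ s, ∀ j ∈ s, lastPos π (A i) < lastPos π (A j) → (A i).ncard ≤ (A j).ncard) :
    2 * ∑ i ∈ s, lastPos π (A i) ≤ pairBound s (fun i => (A i).ncard) := by
  refine le_trans (Nat.mul_le_mul_left 2 (Finset.sum_le_sum fun i hi => ?_))
    (two_mul_sum_waiting_le_pairBound (hA.injOn_lastPos hπ) hmono)
  rw [← ncard_biUnion_finset _
    (hA.disjoint.subset (Finset.coe_subset.2 (Finset.filter_subset _ _)))]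
  rw [← hπ.ncard_setOf_le (hπ.lastPos_le_ncard (hA.subset i hi) (hA.nonempty i hi))]
  refine Set.ncard_le_ncard fun x hx => ?_
  obtain ⟨j, hj, hxj, hji⟩ := hpre i hi x hx.1 hx.2
  simp only [Finset.mem_filter, Set.mem_iUnion, exists_prop]
  refine ⟨j, ⟨hj, ?_⟩, hxj⟩
  rwa [hπ.ncard_setOf_le (hπ.lastPos_le_ncard (hA.subset i hi) (hA.nonempty i hi))]

end

/-! ### Orderings from sort keys -/

section

variable {α κ : Type*} [Finite α] [LinearOrder κ] {S : Set α}

/-- Ranking the elements of `S` by a sort key that is injective on `S`. -/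
theorem isOrdering_ncard_key_le {key : α → κ} (hinj : Set.InjOn key S) :
    IsOrdering S (fun x => {y ∈ S | key y ≤ key x}.ncard) ∧
      ∀ x ∈ S, ∀ y ∈ S,
        {z ∈ S | key z ≤ key x}.ncard < {z ∈ S | key z ≤ key y}.ncard ↔ key x < key y := by
  have hlt : ∀ x, ∀ y ∈ S, key x < key y →
      {z ∈ S | key z ≤ key x}.ncard < {z ∈ S | key z ≤ key y}.ncard := by
    intro x y hy hxy
    have hsub : {z ∈ S | key z ≤ key x} ⊆ {z ∈ S | key z ≤ key y} :=
      fun z hz => ⟨hz.1, hz.2.trans hxy.le⟩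
    refine Set.ncard_lt_ncard ((Set.ssubset_iff_of_subset hsub).2 ⟨y, ⟨hy, le_rfl⟩, ?_⟩)
    exact fun h => absurd h.2 (not_le.2 hxy)
  have hmaps : Set.MapsTo (fun x => {y ∈ S | key y ≤ key x}.ncard) S (Set.Icc 1 S.ncard) := by
    intro x hx
    exact ⟨(Set.ncard_pos).2 ⟨x, hx, le_rfl⟩, Set.ncard_le_ncard fun z hz => hz.1⟩
  have hinj' : Set.InjOn (fun x => {y ∈ S | key y ≤ key x}.ncard) S := by
    intro x hx y hy hxy
    rcases lt_trichotomy (key x) (key y) with h | h | h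
    · exact absurd hxy (hlt x y hy h).ne
    · exact hinj hx hy h
    · exact absurd hxy (hlt y x hx h).ne'
  refine ⟨⟨hmaps, hinj', ?_⟩, fun x hx y hy => ⟨fun h => ?_, hlt x y hy⟩⟩
  · have : (fun x => {y ∈ S | key y ≤ key x}.ncard) '' S = Set.Icc 1 S.ncard := by
      refine Set.eq_of_subset_of_ncard_le hmaps.image_subset ?_ (Set.finite_Icc _ _)
      rw [hinj'.ncard_image, ← Finset.coe_Icc, Set.ncard_coe_finset, Nat.card_Icc]
      omega
    exact this.ge
  · by_contra hle
    rcases (not_lt.1 hle).lt_or_eq with h' | h'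
    · exact absurd (hlt y x hx h') (by omega)
    · exact absurd h (by rw [h']; exact lt_irrefl _)

/-- Ties of a sort key can be broken. -/
theorem exists_isOrdering_of_key (S : Set α) (key : α → κ) :
    ∃ π : α → ℕ, IsOrdering S π ∧ ∀ x ∈ S, ∀ y ∈ S, key x < key y → π x < π y := by
  obtain ⟨n, ⟨e⟩⟩ := Finite.exists_equiv_fin α
  have hinj : Set.InjOn (fun x => toLex (key x, e x)) S := by
    intro x _ y _ hxy
    have := congrArg (fun p => (ofLex p).2) hxy
    exact e.injective this
  obtain ⟨h1, h2⟩ := isOrdering_ncard_key_le hinj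
  exact ⟨_, h1, fun x hx y hy hxy => (h2 x hx y hy).2 (Prod.Lex.toLex_lt_toLex.2 (Or.inl hxy))⟩

end

/-! ### Matroids with pairwise disjoint circuits -/

/-- The matroid has no loops and its circuits are pairwise disjoint. -/
structure HasDisjointCircuits {α : Type*} (M : Matroid α) : Prop where
  one_lt_ncard : ∀ C, M.IsCircuit C → 1 < C.ncard
  disjoint : ∀ C D, M.IsCircuit C → M.IsCircuit D → C ≠ D → Disjoint C D

theorem HasDisjointCircuits.eq_of_mem {α : Type*} {M : Matroid α} (hM : HasDisjointCircuits M)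
    {C D : Set α} (hC : M.IsCircuit C) (hD : M.IsCircuit D) {x : α} (hxC : x ∈ C)
    (hxD : x ∈ D) : C = D := by
  by_contra hne
  exact Set.disjoint_left.1 (hM.disjoint C D hC hD hne) hxC hxD

theorem inter_ground_nonempty {α : Type*} {M : Matroid α} {C : Set α} (hC : M.IsCircuit C) :
    (C ∩ M.E).Nonempty := by
  rw [Set.inter_eq_left.2 hC.subset_ground]
  exact hC.nonempty

section

variable {α : Type*} [Finite α] {M : Matroid α} {B S : Set α} {π σ : α → ℕ}

/-- The finite set of all circuits. -/
noncomputable def circuits (M : Matroid α) : Finset (Set α) :=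
  (Set.toFinite {C | M.IsCircuit C}).toFinset

@[simp] theorem mem_circuits {C : Set α} : C ∈ circuits M ↔ M.IsCircuit C := by
  simp [circuits]

/-- Removing one element from each circuit contained in `S` leaves a basis of `S`. -/
theorem HasDisjointCircuits.eRk_add_card (hM : HasDisjointCircuits M) (hS : S ⊆ M.E)
    [DecidablePred fun C : Set α => C ⊆ S] :
    (M.eRk S).toNat + ((circuits M).filter (· ⊆ S)).card = S.ncard := by
  obtain hα | hα := isEmpty_or_nonempty α
  · have h0 : circuits M = ∅ := Finset.eq_empty_of_forall_notMem fun C hC =>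
      hα.elim (mem_circuits.1 hC).nonempty.some
    simp [h0, Set.eq_empty_of_isEmpty S]
  have hex : ∀ C, M.IsCircuit C → ∃ x, x ∈ C := fun C hC => hC.nonempty
  choose! c hc using hex
  set R : Set α := c '' ((circuits M).filter (· ⊆ S) : Finset (Set α)) with hR
  have hRS : R ⊆ S := by
    rintro _ ⟨C, hC, rfl⟩
    simp only [Finset.coe_filter, Set.mem_ofPred_eq, mem_circuits] at hC
    exact hC.2 (hc C hC.1)
  have hRcard : R.ncard = ((circuits M).filter (· ⊆ S)).card := by
    rw [hR, Set.InjOn.ncard_image, Set.ncard_coe_finset]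
    intro C hC D hD hCD
    simp only [Finset.coe_filter, Set.mem_ofPred_eq, mem_circuits] at hC hD
    exact hM.eq_of_mem hC.1 hD.1 (hc C hC.1) (hCD ▸ hc D hD.1)
  have hbasis : M.IsBasis (S \ R) S := by
    refine Matroid.Indep.isBasis_of_forall_insert ?_ Set.sdiff_subset ?_
    · rw [Matroid.indep_iff_forall_subset_not_isCircuit (Set.sdiff_subset.trans hS)]
      intro C hCS hC
      refine (hCS (hc C hC)).2 ⟨C, ?_, rfl⟩
      simpa using ⟨hC, hCS.trans Set.sdiff_subset⟩
    · rintro x ⟨hxS, hx⟩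
      have hxR : x ∈ R := by
        by_contra h
        exact hx ⟨hxS, h⟩
      obtain ⟨C, hC, rfl⟩ := hxR
      simp only [Finset.coe_filter, Set.mem_ofPred_eq, mem_circuits] at hC
      refine hC.1.dep.superset ?_ (Set.insert_subset (hS hxS) (Set.sdiff_subset.trans hS))
      intro y hy
      by_cases hyR : y ∈ R
      · obtain ⟨D, hD, rfl⟩ := hyR
        simp only [Finset.coe_filter, Set.mem_ofPred_eq, mem_circuits] at hD
        rw [hM.eq_of_mem hC.1 hD.1 hy (hc D hD.1)]
        exact Set.mem_insert _ _
      · exact Or.inr ⟨hC.2 hy, hyR⟩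
  rw [← hbasis.encard_eq_eRk, ← hRcard]
  exact Set.ncard_sdiff_add_ncard_of_subset hRS

/-- Minimising the cost is the same as minimising the sum of the positions in which the circuits
are completed. -/
theorem HasDisjointCircuits.mlopCost_add (hM : HasDisjointCircuits M) (hσ : IsOrdering M.E σ) :
    mlopCost M σ + ∑ C ∈ circuits M, (M.E.ncard + 1 - lastPos σ C) =
      ∑ i ∈ Finset.Icc 1 M.E.ncard, i := by
  classical
  have hswap : ∑ C ∈ circuits M, (M.E.ncard + 1 - lastPos σ C) =
      ∑ i ∈ Finset.Icc 1 M.E.ncard,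
        ((circuits M).filter (· ⊆ {e ∈ M.E | σ e ≤ i})).card := by
    simp only [Finset.card_filter]
    rw [Finset.sum_comm]
    refine Finset.sum_congr rfl fun C hC => ?_
    rw [mem_circuits] at hC
    rw [← Finset.card_filter]
    have h1 : 1 ≤ lastPos σ C := by
      obtain ⟨x, hx⟩ := hC.nonempty
      exact (hσ.one_le (hC.subset_ground hx)).trans (le_lastPos hx)
    have : (Finset.Icc 1 M.E.ncard).filter (fun i => C ⊆ {e ∈ M.E | σ e ≤ i}) =
        Finset.Icc (lastPos σ C) M.E.ncard := by
      ext i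
      simp only [Finset.mem_filter, Finset.mem_Icc]
      constructor
      · rintro ⟨⟨_, h⟩, hi⟩
        exact ⟨lastPos_le hC.nonempty fun x hx => (hi hx).2, h⟩
      · rintro ⟨h, h'⟩
        exact ⟨⟨h1.trans h, h'⟩, fun x hx => ⟨hC.subset_ground hx, (le_lastPos hx).trans h⟩⟩
    rw [this, Nat.card_Icc]
  rw [hswap, mlopCost, ← Finset.sum_add_distrib]
  refine Finset.sum_congr rfl fun i hi => ?_
  rw [hM.eRk_add_card (Set.sep_subset _ _), hσ.ncard_setOf_le (Finset.mem_Icc.1 hi).2]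

theorem HasDisjointCircuits.mlopCost_le_iff (hM : HasDisjointCircuits M) {τ : α → ℕ}
    (hσ : IsOrdering M.E σ) (hτ : IsOrdering M.E τ) :
    mlopCost M σ ≤ mlopCost M τ ↔
      ∑ C ∈ circuits M, lastPos σ C ≤ ∑ C ∈ circuits M, lastPos τ C := by
  have key : ∀ {ρ : α → ℕ}, IsOrdering M.E ρ →
      ∑ C ∈ circuits M, (M.E.ncard + 1 - lastPos ρ C) + ∑ C ∈ circuits M, lastPos ρ C =
        ∑ _C ∈ circuits M, (M.E.ncard + 1) := by
    intro ρ hρ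
    rw [← Finset.sum_add_distrib]
    refine Finset.sum_congr rfl fun C hC => ?_
    rw [mem_circuits] at hC
    have := hρ.lastPos_le_ncard hC.subset_ground hC.nonempty
    omega
  have h1 := key hσ
  have h2 := key hτ
  have h3 := hM.mlopCost_add hσ
  have h4 := hM.mlopCost_add hτ
  omega

/-- An ordering of `S` that runs through the traces of the circuits on `S` one after the other, in
order of non-decreasing size, before everything else. -/
structure IsCircuitwise (M : Matroid α) (S : Set α) (π : α → ℕ) : Prop where
  isOrdering : IsOrdering S π
  consecutive : ∀ C D, M.IsCircuit C → M.IsCircuit D → C ≠ D →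
    ((∀ x ∈ C ∩ S, ∀ y ∈ D ∩ S, π x < π y) ∧ (C ∩ S).ncard ≤ (D ∩ S).ncard) ∨
      ((∀ x ∈ C ∩ S, ∀ y ∈ D ∩ S, π y < π x) ∧ (D ∩ S).ncard ≤ (C ∩ S).ncard)
  coloops_last : ∀ C, M.IsCircuit C → ∀ x ∈ C ∩ S, ∀ y ∈ S, (∀ D, M.IsCircuit D → y ∉ D) →
    π x < π y

theorem HasDisjointCircuits.isDisjointFamily (hM : HasDisjointCircuits M)
    (hne : ∀ C, M.IsCircuit C → (C ∩ S).Nonempty) :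
    IsDisjointFamily S (circuits M) (fun C => C ∩ S) where
  subset _ _ := Set.inter_subset_right
  nonempty C hC := hne C (mem_circuits.1 hC)
  disjoint C hC D hD hCD := by
    simp only [Finset.mem_coe, mem_circuits] at hC hD
    exact (hM.disjoint C D hC hD hCD).mono Set.inter_subset_left Set.inter_subset_left

theorem IsCircuitwise.sum_lastPos_le [DecidableEq (Set α)] (hπ : IsCircuitwise M S π)
    (hM : HasDisjointCircuits M) (hne : ∀ C, M.IsCircuit C → (C ∩ S).Nonempty) :
    2 * ∑ C ∈ circuits M, lastPos π (C ∩ S) ≤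
      pairBound (circuits M) (fun C => (C ∩ S).ncard) := by
  refine (hM.isDisjointFamily hne).sum_lastPos_le_pairBound hπ.isOrdering ?_ ?_
  · intro C hC x hx hxC
    rw [mem_circuits] at hC
    obtain ⟨y, hy, hyC⟩ := exists_eq_lastPos (π := π) (hne C hC)
    by_cases hxD : ∃ D, M.IsCircuit D ∧ x ∈ D
    · obtain ⟨D, hD, hxD⟩ := hxD
      refine ⟨D, mem_circuits.2 hD, ⟨hxD, hx⟩, ?_⟩
      by_cases hCD : C = D
      · rw [hCD]
      · rcases hπ.consecutive C D hC hD hCD with h | h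
        · have := h.1 y hy x ⟨hxD, hx⟩
          omega
        · exact lastPos_le (hne D hD) fun z hz => ((h.1 y hy z hz).le.trans_eq hyC)
    · push Not at hxD
      have := hπ.coloops_last C hC y hy x hx hxD
      omega
  · intro C hC D hD hlt
    rw [mem_circuits] at hC hD
    have hCD : C ≠ D := by
      rintro rfl
      exact lt_irrefl _ hlt
    rcases hπ.consecutive C D hC hD hCD with h | h
    · exact h.2
    · obtain ⟨x, hx, hxC⟩ := exists_eq_lastPos (π := π) (hne C hC)
      obtain ⟨y, hy, hyD⟩ := exists_eq_lastPos (π := π) (hne D hD)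
      have := h.1 x hx y hy
      omega

theorem sum_lastPos_inter_ground (σ : α → ℕ) :
    ∑ C ∈ circuits M, lastPos σ (C ∩ M.E) = ∑ C ∈ circuits M, lastPos σ C :=
  Finset.sum_congr rfl fun C hC => by
    rw [Set.inter_eq_left.2 (mem_circuits.1 hC).subset_ground]

theorem IsCircuitwise.isOptimalOrdering (hσ : IsCircuitwise M M.E σ)
    (hM : HasDisjointCircuits M) : IsOptimalOrdering M σ := by
  classical
  refine ⟨hσ.isOrdering, fun τ hτ => (hM.mlopCost_le_iff hσ.isOrdering hτ).2 ?_⟩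
  have h1 := hσ.sum_lastPos_le hM fun C hC => inter_ground_nonempty hC
  have h2 := (hM.isDisjointFamily fun C hC => inter_ground_nonempty hC).pairBound_le hτ
  rw [sum_lastPos_inter_ground] at h1 h2
  omega

/-- Given one optimal ordering of the special form, every optimal ordering has the least sum of
completion times, which leaves no time for a coloop before the last circuit is completed. -/
theorem IsOptimalOrdering.lt_of_isCircuitwise (hσ : IsOptimalOrdering M σ)
    (hM : HasDisjointCircuits M) {τ : α → ℕ} (hτ : IsCircuitwise M M.E τ) {C : Set α}
    (hC : M.IsCircuit C) {x y : α} (hx : x ∈ C) (hy : y ∈ M.E)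
    (hyD : ∀ D, M.IsCircuit D → y ∉ D) : σ x < σ y := by
  classical
  have h1 := hτ.sum_lastPos_le hM fun C hC => inter_ground_nonempty hC
  have h2 := (hM.mlopCost_le_iff hσ.1 hτ.isOrdering).1 (hσ.2 τ hτ.isOrdering)
  have h3 : 2 * ∑ C ∈ circuits M, lastPos σ (C ∩ M.E) ≤
      pairBound (circuits M) (fun C => (C ∩ M.E).ncard) := by
    rw [sum_lastPos_inter_ground] at h1 ⊢
    omega
  exact (hM.isDisjointFamily fun C hC => inter_ground_nonempty hC).lt_of_sum_le_pairBound hσ.1 h3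
    (mem_circuits.2 hC) ⟨hx, hC.subset_ground hx⟩ hy
    fun D hD h => hyD D (mem_circuits.1 hD) h.1

end

/-! ### Bases of matroids with disjoint circuits -/

/-- A basis misses exactly one element of each circuit. -/
theorem HasDisjointCircuits.exists_sdiff_isBase_eq {α : Type*} {M : Matroid α} {B : Set α}
    (hM : HasDisjointCircuits M) (hB : M.IsBase B) {C : Set α} (hC : M.IsCircuit C) :
    ∃ e, C \ B = {e} := by
  obtain ⟨e, heC, heB⟩ : ∃ e ∈ C, e ∉ B :=
    Set.not_subset.1 fun h => hC.not_indep (hB.indep.subset h)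
  refine ⟨e, Set.eq_singleton_iff_unique_mem.2 ⟨⟨heC, heB⟩, fun f hf => ?_⟩⟩
  have hfund := hB.fundCircuit_isCircuit (hC.subset_ground hf.1) hf.2
  have := hM.eq_of_mem hC hfund hf.1 (M.mem_fundCircuit f B)
  have he := M.fundCircuit_subset_insert f B (this ▸ heC)
  rcases he with he | he
  · exact he.symm
  · exact absurd he heB

theorem HasDisjointCircuits.fundCircuit_eq {α : Type*} {M : Matroid α} {B : Set α}
    (hM : HasDisjointCircuits M) (hB : M.IsBase B) {C : Set α}
    (hC : M.IsCircuit C) {e : α} (heC : e ∈ C) (heB : e ∉ B) :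
    M.fundCircuit e B = C :=
  hM.eq_of_mem (hB.fundCircuit_isCircuit (hC.subset_ground heC) heB) hC
    (M.mem_fundCircuit e B) heC

theorem HasDisjointCircuits.circuitMax_eq {α : Type*} {M : Matroid α} {B : Set α}
    {π : α → ℕ} (hM : HasDisjointCircuits M) (hB : M.IsBase B) {C : Set α}
    (hC : M.IsCircuit C) {e : α} (heC : e ∈ C) (heB : e ∉ B) :
    circuitMax M B π e = lastPos π (C ∩ B) := by
  rw [circuitMax, M.fundCircuit_sdiff_eq_inter heB, hM.fundCircuit_eq hB hC heC heB, lastPos]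

section

variable {α : Type*} [Finite α] {M : Matroid α} {B S : Set α} {π σ : α → ℕ}

theorem HasDisjointCircuits.ncard_inter_isBase (hM : HasDisjointCircuits M) (hB : M.IsBase B)
    {C : Set α} (hC : M.IsCircuit C) : (C ∩ B).ncard + 1 = C.ncard := by
  obtain ⟨e, he⟩ := hM.exists_sdiff_isBase_eq hB hC
  rw [← Set.ncard_inter_add_ncard_sdiff_eq_ncard C B, he, Set.ncard_singleton]

theorem HasDisjointCircuits.inter_isBase_nonempty (hM : HasDisjointCircuits M) (hB : M.IsBase B)
    {C : Set α} (hC : M.IsCircuit C) : (C ∩ B).Nonempty := by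
  have h1 := hM.ncard_inter_isBase hB hC
  have h2 := hM.one_lt_ncard C hC
  exact (Set.ncard_pos).1 (by omega)

theorem HasDisjointCircuits.basisCost_eq (hM : HasDisjointCircuits M) (hB : M.IsBase B) :
    basisCost M B π = ∑ C ∈ circuits M, lastPos π (C ∩ B) := by
  have hbij : Set.BijOn (fun e => M.fundCircuit e B) (M.E \ B) (circuits M : Finset (Set α)) := by
    refine ⟨fun e he => ?_, fun e he f hf hef => ?_, fun C hC => ?_⟩
    · simpa using hB.fundCircuit_isCircuit he.1 he.2
    · have hC := hB.fundCircuit_isCircuit he.1 he.2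
      obtain ⟨g, hg⟩ := hM.exists_sdiff_isBase_eq hB hC
      have h1 : e ∈ M.fundCircuit e B \ B := ⟨M.mem_fundCircuit e B, he.2⟩
      have h2 : f ∈ M.fundCircuit e B \ B := by
        simp only at hef
        rw [hef]
        exact ⟨M.mem_fundCircuit f B, hf.2⟩
      rw [hg] at h1 h2
      rw [Set.mem_singleton_iff.1 h1, Set.mem_singleton_iff.1 h2]
    · have hC' : M.IsCircuit C := by simpa using hC
      obtain ⟨e, he⟩ := hM.exists_sdiff_isBase_eq hB hC'
      have heC : e ∈ C \ B := he ▸ Set.mem_singleton e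
      exact ⟨e, ⟨hC'.subset_ground heC.1, heC.2⟩, hM.fundCircuit_eq hB hC' heC.1 heC.2⟩
  rw [basisCost, finsum_mem_eq_of_bijOn _ hbij (g := fun C => lastPos π (C ∩ B)),
    finsum_mem_coe_finset]
  intro e he
  exact hM.circuitMax_eq hB (hB.fundCircuit_isCircuit he.1 he.2) (M.mem_fundCircuit e B) he.2

/-- All bases lead to the same scheduling problem, with processing times one less than the sizes of
the circuits. -/
theorem IsCircuitwise.basisCost_le (hπ : IsCircuitwise M S π) (hM : HasDisjointCircuits M)
    (hS : M.IsBase S) (hB : M.IsBase B) {π' : α → ℕ} (hπ' : IsOrdering B π') :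
    basisCost M S π ≤ basisCost M B π' := by
  classical
  have h1 := hπ.sum_lastPos_le hM fun C hC => hM.inter_isBase_nonempty hS hC
  have h2 := (hM.isDisjointFamily fun C hC => hM.inter_isBase_nonempty hB hC).pairBound_le hπ'
  have h3 : pairBound (circuits M) (fun C => (C ∩ S).ncard) =
      pairBound (circuits M) (fun C => (C ∩ B).ncard) := by
    have hc : ∀ C ∈ circuits M, (C ∩ S).ncard = (C ∩ B).ncard := fun C hC => by
      have := hM.ncard_inter_isBase hS (mem_circuits.1 hC)
      have := hM.ncard_inter_isBase hB (mem_circuits.1 hC)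
      omega
    exact Finset.sum_congr rfl fun C hC => Finset.sum_congr rfl fun D hD => by
      simp only [hc C hC, hc D hD]
  rw [hM.basisCost_eq hS, hM.basisCost_eq hB]
  omega

theorem exists_extendsBasisOrdering (M : Matroid α) (hB : B ⊆ M.E) (hπ : IsOrdering B π) :
    ∃ σ, ExtendsBasisOrdering M B π σ := by
  classical
  obtain ⟨σ, hσ, hkey⟩ := exists_isOrdering_of_key M.E
    (fun x => if x ∈ B then 2 * π x else 2 * circuitMax M B π x + 1)
  have hlt : ∀ b ∈ B, ∀ b' ∈ B, π b < π b' → σ b < σ b' := fun b hb b' hb' h =>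
    hkey b (hB hb) b' (hB hb') (by rw [if_pos hb, if_pos hb']; omega)
  refine ⟨σ, hσ, fun b hb b' hb' => ⟨fun h => ?_, hlt b hb b' hb'⟩, fun b hb e he h => ?_,
    fun b hb e he h => ?_⟩
  · by_contra hle
    rcases (not_lt.1 hle).lt_or_eq with h' | h'
    · have := hlt b' hb' b hb h'
      omega
    · rw [hπ.injOn hb' hb h'] at h
      exact lt_irrefl _ h
  · exact hkey b (hB hb) e he.1 (by rw [if_pos hb, if_neg he.2]; omega)
  · exact hkey e he.1 b (hB hb) (by rw [if_pos hb, if_neg he.2]; omega)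

theorem ExtendsBasisOrdering.isCircuitwise (hσ : ExtendsBasisOrdering M B π σ)
    (hM : HasDisjointCircuits M) (hB : M.IsBase B) (hπ : IsCircuitwise M B π) :
    IsCircuitwise M M.E σ := by
  have hbefore : ∀ C, M.IsCircuit C → ∀ x ∈ C, ∀ b ∈ B, (∀ x ∈ C ∩ B, π x < π b) → σ x < σ b := by
    intro C hC x hx b hb h
    by_cases hxB : x ∈ B
    · exact (hσ.basis_lt x hxB b hb).2 (h x ⟨hx, hxB⟩)
    · refine hσ.before b hb x ⟨hC.subset_ground hx, hxB⟩ ?_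
      rw [hM.circuitMax_eq hB hC hx hxB]
      obtain ⟨y, hy, hyC⟩ := exists_eq_lastPos (π := π) (hM.inter_isBase_nonempty hB hC)
      exact hyC ▸ h y hy
  have hpair : ∀ C D, M.IsCircuit C → M.IsCircuit D →
      (∀ x ∈ C ∩ B, ∀ y ∈ D ∩ B, π x < π y) → ∀ x ∈ C, ∀ y ∈ D, σ x < σ y := by
    intro C D hC hD h x hx y hy
    by_cases hyB : y ∈ B
    · exact hbefore C hC x hx y hyB fun z hz => h z hz y ⟨hy, hyB⟩
    · obtain ⟨b, hb⟩ := hM.inter_isBase_nonempty hB hD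
      refine (hbefore C hC x hx b hb.2 fun z hz => h z hz b hb).trans
        (hσ.after b hb.2 y ⟨hD.subset_ground hy, hyB⟩ ?_)
      rw [hM.circuitMax_eq hB hD hy hyB]
      exact le_lastPos hb
  refine ⟨hσ.isOrdering, fun C D hC hD hCD => ?_, fun C hC x hx y hy hyD => ?_⟩
  · rw [Set.inter_eq_left.2 hC.subset_ground, Set.inter_eq_left.2 hD.subset_ground]
    have h1 := hM.ncard_inter_isBase hB hC
    have h2 := hM.ncard_inter_isBase hB hD
    rcases hπ.consecutive C D hC hD hCD with h | h
    · exact Or.inl ⟨hpair C D hC hD h.1, by omega⟩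
    · exact Or.inr ⟨fun x hx y hy => hpair D C hD hC (fun z hz w hw => h.1 w hw z hz) y hy x hx,
        by omega⟩
  · have hyB : y ∈ B := by
      by_contra hyB
      exact hyD _ (hB.fundCircuit_isCircuit hy hyB) (M.mem_fundCircuit y B)
    exact hbefore C hC x hx.1 y hyB fun z hz => hπ.coloops_last C hC z hz y hyB hyD

end

/-! ### Circuits of the graphic matroid -/

section

open SimpleGraph

variable {V : Type*} {G : SimpleGraph V}

theorem edgeSet_toSubgraph_eq {u v : V} (c : G.Walk u v) :
    c.toSubgraph.edgeSet = {e | e ∈ c.edges} :=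
  Set.ext fun _ => c.mem_edges_toSubgraph

theorem two_lt_ncard_edgeSet_of_isCycle {v : V} {c : G.Walk v v} (hc : c.IsCycle) :
    2 < c.toSubgraph.edgeSet.ncard := by
  classical
  rw [edgeSet_toSubgraph_eq]
  have h : {e | e ∈ c.edges} = (c.edges.toFinset : Set (Sym2 V)) := by
    ext
    simp
  rw [h, Set.ncard_coe_finset, List.toFinset_card_of_nodup hc.edges_nodup, Walk.length_edges]
  exact hc.three_le_length

/-- A cycle contained in a cycle is all of it, because every vertex of a cycle has degree two. -/
theorem edgeSet_eq_of_isCycle_of_subset {x y : V} {c : G.Walk x x} {d : G.Walk y y}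
    (hc : c.IsCycle) (hd : d.IsCycle) (h : c.toSubgraph.edgeSet ⊆ d.toSubgraph.edgeSet) :
    c.toSubgraph.edgeSet = d.toSubgraph.edgeSet := by
  have hadj : ∀ v w, c.toSubgraph.Adj v w → d.toSubgraph.Adj v w := fun v w hvw =>
    Subgraph.mem_edgeSet.1 (h (Subgraph.mem_edgeSet.2 hvw))
  have hback : ∀ v ∈ c.toSubgraph.verts, ∀ w, d.toSubgraph.Adj v w → c.toSubgraph.Adj v w := by
    intro v hv w hvw
    have h1 := hc.ncard_neighborSet_toSubgraph_eq_two ((c.mem_verts_toSubgraph).1 hv)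
    have h2 := hd.ncard_neighborSet_toSubgraph_eq_two
      ((d.mem_verts_toSubgraph).1 (d.toSubgraph.edge_vert hvw))
    have heq := Set.eq_of_subset_of_ncard_le (s := c.toSubgraph.neighborSet v)
      (t := d.toSubgraph.neighborSet v) (fun w hw => hadj v w hw) (by omega)
      (d.finite_neighborSet_toSubgraph)
    have : w ∈ d.toSubgraph.neighborSet v := hvw
    rw [← heq] at this
    exact this
  have hx : x ∈ d.toSubgraph.verts :=
    d.toSubgraph.edge_vert (hadj x c.snd (c.toSubgraph_adj_snd hc.not_nil))
  have hwalk : ∀ (a b : d.toSubgraph.verts), d.toSubgraph.coe.Walk a b →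
      (a : V) ∈ c.toSubgraph.verts → (b : V) ∈ c.toSubgraph.verts := by
    intro a b p
    induction p with
    | nil => exact id
    | cons hab _ ih => exact fun ha => ih (c.toSubgraph.edge_vert (hback _ ha _ hab).symm)
  refine h.antisymm fun e => ?_
  induction e with
  | h v w =>
    intro hvw
    have hvw' : d.toSubgraph.Adj v w := hvw
    obtain ⟨p⟩ := d.toSubgraph_connected.preconnected.coe ⟨x, hx⟩ ⟨v, d.toSubgraph.edge_vert hvw'⟩
    exact hback v (hwalk _ _ p c.start_mem_verts_toSubgraph) w hvw'

/-- A forest fails to be one because of a cycle of the ambient graph. -/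
theorem exists_isCycle_of_not_isAcyclic {F : Set (Sym2 V)} (hF : F ⊆ G.edgeSet)
    (h : ¬ (fromEdgeSet F).IsAcyclic) :
    ∃ (v : V) (c : G.Walk v v), c.IsCycle ∧ c.toSubgraph.edgeSet ⊆ F := by
  have hle : fromEdgeSet F ≤ G := by
    rw [← G.fromEdgeSet_edgeSet]
    exact fromEdgeSet_mono hF
  simp only [IsAcyclic, not_forall, not_not] at h
  obtain ⟨v, c, hc⟩ := h
  refine ⟨v, c.mapLe hle, hc.mapLe hle, ?_⟩
  rw [edgeSet_toSubgraph_eq]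
  intro e he
  have he' : e ∈ c.edges := by simpa using he
  have := c.edges_subset_edgeSet he'
  rw [edgeSet_fromEdgeSet] at this
  exact this.1

theorem not_isAcyclic_of_isCycle {v : V} {c : G.Walk v v} (hc : c.IsCycle) {F : Set (Sym2 V)}
    (h : c.toSubgraph.edgeSet ⊆ F) : ¬ (fromEdgeSet F).IsAcyclic := by
  intro hF
  have hmem : ∀ e ∈ c.edges, e ∈ (fromEdgeSet F).edgeSet := by
    intro e he
    rw [edgeSet_fromEdgeSet]
    refine ⟨h (c.mem_edges_toSubgraph.2 he), ?_⟩
    have := G.not_isDiag_of_mem_edgeSet (c.edges_subset_edgeSet he)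
    simpa using this
  exact hF _ (hc.transfer hmem)

variable [Finite V]

theorem graphicMatroid_ground (G : SimpleGraph V) : (graphicMatroid G).E = G.edgeSet := rfl

theorem graphicMatroid_indep_iff {F : Set (Sym2 V)} :
    (graphicMatroid G).Indep F ↔ F ⊆ G.edgeSet ∧ (fromEdgeSet F).IsAcyclic := by
  simp [graphicMatroid]

theorem isCircuit_graphicMatroid_iff {C : Set (Sym2 V)} :
    (graphicMatroid G).IsCircuit C ↔
      ∃ (v : V) (c : G.Walk v v), c.IsCycle ∧ C = c.toSubgraph.edgeSet := by
  have hdep : ∀ {v : V} {c : G.Walk v v}, c.IsCycle →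
      (graphicMatroid G).Dep c.toSubgraph.edgeSet := by
    intro v c hc
    exact ⟨fun h => not_isAcyclic_of_isCycle hc subset_rfl (graphicMatroid_indep_iff.1 h).2,
      c.toSubgraph.edgeSet_subset⟩
  have hmp : ∀ {C : Set (Sym2 V)}, (graphicMatroid G).IsCircuit C →
      ∃ (v : V) (c : G.Walk v v), c.IsCycle ∧ C = c.toSubgraph.edgeSet := by
    intro C hC
    obtain ⟨v, c, hc, hcC⟩ := exists_isCycle_of_not_isAcyclic (G := G) hC.subset_ground fun h =>
      hC.not_indep (graphicMatroid_indep_iff.2 ⟨hC.subset_ground, h⟩)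
    exact ⟨v, c, hc, (hC.eq_of_dep_subset (hdep hc) hcC).symm⟩
  refine ⟨hmp, ?_⟩
  rintro ⟨v, c, hc, rfl⟩
  obtain ⟨D, hDC, hD⟩ := (hdep hc).exists_isCircuit_subset
  obtain ⟨w, d, hd, rfl⟩ := hmp hD
  rwa [edgeSet_eq_of_isCycle_of_subset hd hc hDC] at hD

theorem isBridge_iff_forall_isCircuit {e : Sym2 V} (he : e ∈ G.edgeSet) :
    G.IsBridge e ↔ ∀ C, (graphicMatroid G).IsCircuit C → e ∉ C := by
  rw [isBridge_iff_forall_cycle_notMem he]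
  constructor
  · intro h C hC heC
    obtain ⟨v, c, hc, rfl⟩ := isCircuit_graphicMatroid_iff.1 hC
    exact h c hc (c.mem_edges_toSubgraph.1 heC)
  · intro h v c hc hec
    exact h _ (isCircuit_graphicMatroid_iff.2 ⟨v, c, hc, rfl⟩) (c.mem_edges_toSubgraph.2 hec)

/-- The ends of an edge remain connected after deletion of this edge and of `e` exactly if some
circuit through the edge avoids `e`, unless `e` is the edge itself. -/
theorem reachable_deleteEdges_pair_iff {x y : V} (hxy : G.Adj x y) (e : Sym2 V) :
    (G.deleteEdges {e, s(x, y)}).Reachable x y ↔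
      ∃ C, (graphicMatroid G).IsCircuit C ∧ s(x, y) ∈ C ∧ (e ∈ C → e = s(x, y)) := by
  constructor
  · intro h
    by_cases he : e = s(x, y)
    · subst he
      rw [Set.pair_eq_singleton] at h
      obtain ⟨v, c, hc, hmem⟩ := adj_and_reachable_delete_edges_iff_exists_cycle.1 ⟨hxy, h⟩
      exact ⟨_, isCircuit_graphicMatroid_iff.2 ⟨v, c, hc, rfl⟩, c.mem_edges_toSubgraph.2 hmem,
        fun _ => rfl⟩
    · rw [Set.insert_eq, ← deleteEdges_deleteEdges] at h
      have hadj : (G.deleteEdges {e}).Adj x y := by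
        rw [deleteEdges_adj]
        exact ⟨hxy, fun h => he h.symm⟩
      obtain ⟨v, c, hc, hmem⟩ := adj_and_reachable_delete_edges_iff_exists_cycle.1 ⟨hadj, h⟩
      have hle := G.deleteEdges_le {e}
      refine ⟨_, isCircuit_graphicMatroid_iff.2 ⟨v, c.mapLe hle, hc.mapLe hle, rfl⟩, ?_, ?_⟩
      · rw [edgeSet_toSubgraph_eq]
        simpa using hmem
      · intro h'
        rw [edgeSet_toSubgraph_eq] at h'
        have h'' : e ∈ c.edges := by simpa using h'
        have := c.edges_subset_edgeSet h''
        rw [edgeSet_deleteEdges] at this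
        exact absurd rfl this.2
  · rintro ⟨C, hC, hmem, heC⟩
    obtain ⟨v, c, hc, rfl⟩ := isCircuit_graphicMatroid_iff.1 hC
    rw [c.mem_edges_toSubgraph] at hmem heC
    by_cases he : e = s(x, y)
    · rw [he, Set.pair_eq_singleton]
      exact (adj_and_reachable_delete_edges_iff_exists_cycle.2 ⟨v, c, hc, hmem⟩).2
    · have hec : ∀ f ∈ c.edges, f ∈ (G.deleteEdges {e}).edgeSet := by
        intro f hf
        rw [edgeSet_deleteEdges]
        refine ⟨c.edges_subset_edgeSet hf, ?_⟩
        rintro rfl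
        exact he (heC hf)
      rw [Set.insert_eq, ← deleteEdges_deleteEdges]
      exact (adj_and_reachable_delete_edges_iff_exists_cycle.2
        ⟨v, c.transfer _ hec, hc.transfer hec, by simpa using hmem⟩).2

end

/-! ### Blocks and cactus graphs -/

section

open SimpleGraph

variable {V : Type*} {G : SimpleGraph V}

theorem hasNoCutVertex_of_isCycle {x : V} {c : G.Walk x x} (hc : c.IsCycle) :
    HasNoCutVertex c.toSubgraph := by
  classical
  intro v hv
  have hvs : v ∈ c.support := (c.mem_verts_toSubgraph).1 hv
  rw [← c.toSubgraph_rotate hvs]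
  have hc' := hc.rotate hvs
  generalize c.rotate v hvs = d at hc'
  cases d with
  | nil => exact absurd hc' Walk.not_isCycle_nil
  | cons h p =>
    rename_i w
    have hp : p.reverse.IsPath := ((Walk.cons_isCycle_iff p h).1 hc').1.reverse
    have hsub : (Walk.cons h p).toSubgraph = G.subgraphOfAdj h ⊔ p.reverse.toSubgraph := by
      rw [Walk.toSubgraph, p.toSubgraph_reverse]
    rw [hsub]
    generalize p.reverse = q at hp
    cases q with
    | nil => exact absurd h G.irrefl
    | cons h' r =>
      -- `r` is what remains of the cycle when `v` is deleted.
      have hvr : v ∉ r.support := ((Walk.cons_isPath_iff h' r).1 hp).2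
      have hrv : ∀ a ∈ r.toSubgraph.verts, a ≠ v := by
        rintro a ha rfl
        exact hvr ((r.mem_verts_toSubgraph).1 ha)
      refine (r.toSubgraph_connected.mono' (fun a b hab => ?_) ?_).preconnected
      · rw [Subgraph.deleteVerts_adj]
        have ha := r.toSubgraph.edge_vert hab
        have hb := r.toSubgraph.edge_vert hab.symm
        exact ⟨Or.inr (Or.inr ha), hrv a ha, Or.inr (Or.inr hb), hrv b hb, Or.inr (Or.inr hab)⟩
      · ext a
        have hs := r.start_mem_verts_toSubgraph
        have ht := r.end_mem_verts_toSubgraph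
        simp only [Walk.toSubgraph, Subgraph.deleteVerts_verts, Subgraph.verts_sup,
          subgraphOfAdj_verts, Set.mem_sdiff, Set.mem_union, Set.mem_insert_iff,
          Set.mem_singleton_iff]
        constructor
        · exact fun ha => ⟨Or.inr (Or.inr ha), hrv a ha⟩
        · rintro ⟨(rfl | rfl) | (rfl | rfl) | ha, hav⟩ <;> first | assumption | exact absurd rfl hav

/-- Two connected subgraphs without cut vertices that share an edge have a union of this kind. -/
theorem connected_and_hasNoCutVertex_sup {H K : G.Subgraph} (hH : H.Connected)
    (hK : K.Connected) (hH' : HasNoCutVertex H) (hK' : HasNoCutVertex K) {a b : V}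
    (hab : H.Adj a b) (hab' : K.Adj a b) : (H ⊔ K).Connected ∧ HasNoCutVertex (H ⊔ K) := by
  have hdel : ∀ {L : G.Subgraph}, L.Connected → HasNoCutVertex L →
      ∀ v, (L.deleteVerts {v}).Preconnected := by
    intro L hL hL' v
    by_cases hv : v ∈ L.verts
    · exact hL' v hv
    · rw [← Subgraph.deleteVerts_inter_verts_left_eq, Set.inter_singleton_eq_empty.2 hv,
        Subgraph.deleteVerts_empty]
      exact hL.preconnected
  refine ⟨Subgraph.connected_sup hH.preconnected hK.preconnected
    ⟨a, H.edge_vert hab, K.edge_vert hab'⟩, fun v _ => ?_⟩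
  obtain ⟨w, hwH, hwK, hwv⟩ : ∃ w, w ∈ H.verts ∧ w ∈ K.verts ∧ w ≠ v := by
    by_cases ha : a = v
    · exact ⟨b, H.edge_vert hab.symm, K.edge_vert hab'.symm, fun h => hab.ne (ha.trans h.symm)⟩
    · exact ⟨a, H.edge_vert hab, K.edge_vert hab', ha⟩
  refine (Subgraph.Connected.mono' (fun x y hxy => ?_) ?_
    (Subgraph.connected_sup (hdel hH hH' v) (hdel hK hK' v) ⟨w, ⟨hwH, hwv⟩, hwK, hwv⟩)).preconnected
  · simp only [Subgraph.sup_adj, Subgraph.deleteVerts_adj, Subgraph.verts_sup,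
      Set.mem_union] at hxy ⊢
    tauto
  · ext x
    simp only [Subgraph.deleteVerts_verts, Subgraph.verts_sup, Set.mem_union, Set.mem_sdiff]
    tauto

theorem IsBlock.eq_of_adj {H K : G.Subgraph} (hH : IsBlock H) (hK : IsBlock K) {a b : V}
    (hab : H.Adj a b) (hab' : K.Adj a b) : H = K := by
  have h := connected_and_hasNoCutVertex_sup hH.prop.1 hK.prop.1 hH.prop.2 hK.prop.2 hab hab'
  exact (hH.eq_of_le h le_sup_left).trans (hK.eq_of_le h le_sup_right).symm

variable [Finite V]

theorem exists_isBlock_ge {H : G.Subgraph} (h : H.Connected) (h' : HasNoCutVertex H) :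
    ∃ K, IsBlock K ∧ H ≤ K := by
  obtain ⟨K, hHK, hK⟩ := (Set.toFinite {H' : G.Subgraph | H'.Connected ∧ HasNoCutVertex H'})
    |>.exists_le_maximal (a := H) ⟨h, h'⟩
  exact ⟨K, hK, hHK⟩

theorem IsCactus.exists_isBlock_edgeSet_eq (hG : IsCactus G) {x : V} {c : G.Walk x x}
    (hc : c.IsCycle) :
    ∃ H : G.Subgraph, IsBlock H ∧ IsCycleSubgraph H ∧ H.edgeSet = c.toSubgraph.edgeSet := by
  obtain ⟨H, hH, hcH⟩ := exists_isBlock_ge c.toSubgraph_connected (hasNoCutVertex_of_isCycle hc)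
  have hsub : c.toSubgraph.edgeSet ⊆ H.edgeSet := Subgraph.edgeSet_mono hcH
  have hcard := two_lt_ncard_edgeSet_of_isCycle hc
  have hle := Set.ncard_le_ncard hsub
  rcases hG H hH with ⟨v, rfl⟩ | ⟨u, v, h, rfl⟩ | hcyc
  · rw [edgeSet_singletonSubgraph, Set.ncard_empty] at hle
    omega
  · rw [edgeSet_subgraphOfAdj, Set.ncard_singleton] at hle
    omega
  · refine ⟨H, hH, hcyc, ?_⟩
    obtain ⟨y, d, hd, rfl⟩ := hcyc
    exact (edgeSet_eq_of_isCycle_of_subset hc hd hsub).symm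

theorem IsCactus.isCircuit_iff (hG : IsCactus G) {C : Set (Sym2 V)} :
    (graphicMatroid G).IsCircuit C ↔
      ∃ H : G.Subgraph, IsBlock H ∧ IsCycleSubgraph H ∧ H.edgeSet = C := by
  rw [isCircuit_graphicMatroid_iff]
  constructor
  · rintro ⟨v, c, hc, rfl⟩
    exact hG.exists_isBlock_edgeSet_eq hc
  · rintro ⟨H, -, ⟨v, c, hc, rfl⟩, rfl⟩
    exact ⟨v, c, hc, rfl⟩

theorem IsCactus.hasDisjointCircuits (hG : IsCactus G) :
    HasDisjointCircuits (graphicMatroid G) where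
  one_lt_ncard C hC := by
    obtain ⟨v, c, hc, rfl⟩ := isCircuit_graphicMatroid_iff.1 hC
    have := two_lt_ncard_edgeSet_of_isCycle hc
    omega
  disjoint C D hC hD hne := by
    obtain ⟨H, hH, -, rfl⟩ := hG.isCircuit_iff.1 hC
    obtain ⟨K, hK, -, rfl⟩ := hG.isCircuit_iff.1 hD
    refine Set.disjoint_left.2 fun e => ?_
    induction e with
    | h a b =>
      intro ha hb
      exact hne (congrArg _ (hH.eq_of_adj hK ha hb))

end

/-! ### Greedy orderings of spanning forests -/

section

variable {V : Type*} [Finite V] {G : SimpleGraph V} {T : Set (Sym2 V)} {π : Sym2 V → ℕ}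

theorem IsGreedyOrdering.isCircuitwise (hG : IsCactus G) (hT : (graphicMatroid G).IsBase T)
    (hπ : IsGreedyOrdering G T π) : IsCircuitwise (graphicMatroid G) T π where
  isOrdering := hπ.isOrdering
  consecutive C D hC hD hne := by
    obtain ⟨c, B, -, hrange, hmono, hlt⟩ := hπ.blocks
    have hex : ∀ C, (graphicMatroid G).IsCircuit C → ∃ i, (B i).edgeSet = C := by
      intro C hC
      obtain ⟨H, hH, hH', rfl⟩ := hG.isCircuit_iff.1 hC
      obtain ⟨i, rfl⟩ : H ∈ Set.range B := hrange ▸ ⟨hH, hH'⟩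
      exact ⟨i, rfl⟩
    have h1 := hG.hasDisjointCircuits.ncard_inter_isBase hT hC
    have h2 := hG.hasDisjointCircuits.ncard_inter_isBase hT hD
    obtain ⟨i, rfl⟩ := hex C hC
    obtain ⟨j, rfl⟩ := hex D hD
    rcases lt_trichotomy i j with hij | rfl | hij
    · have := hmono hij.le
      exact Or.inl ⟨fun x hx y hy => hlt i j hij x hx.symm y hy.symm, by simp only at this; omega⟩
    · exact absurd rfl hne
    · have := hmono hij.le
      exact Or.inr ⟨fun x hx y hy => hlt j i hij y hy.symm x hx.symm, by simp only at this; omega⟩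
  coloops_last C hC x hx y hy hyD := by
    refine hπ.bridges_last x hx.2 y hy ?_ ?_
    · rw [isBridge_iff_forall_isCircuit (hC.subset_ground hx.1)]
      exact fun h => h C hC hx.1
    · exact (isBridge_iff_forall_isCircuit (hT.subset_ground hy)).2 hyD

theorem IsCactus.exists_isGreedyOrdering (hG : IsCactus G)
    (hT : (graphicMatroid G).IsBase T) : ∃ π, IsGreedyOrdering G T π := by
  classical
  obtain ⟨c, ⟨e⟩⟩ := Finite.exists_equiv_fin {H : G.Subgraph // IsBlock H ∧ IsCycleSubgraph H}
  let f : Fin c → ℕ := fun i => (e.symm i).1.edgeSet.ncard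
  let B : Fin c → G.Subgraph := fun i => (e.symm (Tuple.sort f i)).1
  have hinj : Function.Injective B := Subtype.val_injective.comp
    (e.symm.injective.comp (Tuple.sort f).injective)
  have hrange : Set.range B = {H | IsBlock H ∧ IsCycleSubgraph H} := by
    ext H
    constructor
    · rintro ⟨i, rfl⟩
      exact (e.symm (Tuple.sort f i)).2
    · intro hH
      exact ⟨(Tuple.sort f).symm (e ⟨H, hH⟩), by simp [B]⟩
  have huniq : ∀ i j x, x ∈ (B i).edgeSet → x ∈ (B j).edgeSet → i = j := by
    intro i j x
    induction x with
    | h a b => exact fun hi hj => hinj (((e.symm _).2.1).eq_of_adj ((e.symm _).2.1) hi hj)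
  let key : Sym2 V → ℕ := fun x => if h : ∃ i, x ∈ (B i).edgeSet then h.choose else c
  have hkey : ∀ i x, x ∈ (B i).edgeSet → key x = i := by
    intro i x hx
    have h : ∃ i, x ∈ (B i).edgeSet := ⟨i, hx⟩
    simp only [key, dif_pos h, huniq _ _ x h.choose_spec hx]
  have hbridge : ∀ x ∈ G.edgeSet, G.IsBridge x ↔ ∀ i, x ∉ (B i).edgeSet := by
    intro x hx
    rw [isBridge_iff_forall_isCircuit hx]
    constructor
    · intro h i
      exact h _ (hG.isCircuit_iff.2 ⟨B i, (e.symm _).2.1, (e.symm _).2.2, rfl⟩)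
    · intro h C hC
      obtain ⟨H, hH, hH', rfl⟩ := hG.isCircuit_iff.1 hC
      obtain ⟨i, rfl⟩ : H ∈ Set.range B := hrange ▸ ⟨hH, hH'⟩
      exact h i
  obtain ⟨π, hπ, hπkey⟩ := exists_isOrdering_of_key T key
  refine ⟨π, hπ, fun x hx y hy hxb hyb => ?_, c, B, hinj, hrange, Tuple.monotone_sort f, ?_⟩
  · rw [hbridge x (hT.subset_ground hx)] at hxb
    rw [hbridge y (hT.subset_ground hy)] at hyb
    push Not at hxb
    obtain ⟨i, hi⟩ := hxb
    refine hπkey x hx y hy ?_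
    rw [hkey i x hi]
    simp [key, hyb]
  · intro i j hij x hx y hy
    refine hπkey x hx.1 y hy.1 ?_
    rw [hkey i x hx.2, hkey j y hy.2]
    exact hij

theorem IsCactus.exists_isCircuitwise (hG : IsCactus G) :
    ∃ σ, IsCircuitwise (graphicMatroid G) (graphicMatroid G).E σ := by
  obtain ⟨T, hT⟩ := (graphicMatroid G).exists_isBase
  obtain ⟨π, hπ⟩ := hG.exists_isGreedyOrdering hT
  obtain ⟨σ, hσ⟩ := exists_extendsBasisOrdering (graphicMatroid G) hT.subset_ground hπ.isOrdering
  exact ⟨σ, hσ.isCircuitwise hG.hasDisjointCircuits hT (hπ.isCircuitwise hG hT)⟩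

theorem IsCactus.lt_of_isOptimalOrdering (hG : IsCactus G) {σ : Sym2 V → ℕ}
    (hσ : IsOptimalOrdering (graphicMatroid G) σ) {e f : Sym2 V} (he : e ∈ G.edgeSet)
    (hf : f ∈ G.edgeSet) (heb : ¬ G.IsBridge e) (hfb : G.IsBridge f) : σ e < σ f := by
  obtain ⟨τ, hτ⟩ := hG.exists_isCircuitwise
  rw [isBridge_iff_forall_isCircuit he] at heb
  rw [isBridge_iff_forall_isCircuit hf] at hfb
  push Not at heb
  obtain ⟨C, hC, heC⟩ := heb
  exact hσ.lt_of_isCircuitwise hG.hasDisjointCircuits hτ hC heC hf hfb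

end

/-! ### Loop programs -/

/-- Programs whose only loops are of the form `for x = 0, …, (var b) - 1`, with `b` the number of a
variable. -/
inductive LoopProg : Type
  | skip
  | assign (x : ℕ) (e : RamExpr)
  | store (a : ℕ) (i e : RamExpr)
  | seq (p q : LoopProg)
  | ite (b : RamExpr) (p q : LoopProg)
  | forTo (x b : ℕ) (p : LoopProg)

namespace LoopProg

/-- The translation into the language of the random access machine. -/
def toRam : LoopProg → RamProg
  | skip => .skip
  | assign x e => .assign x e
  | store a i e => .store a i e
  | seq p q => .seq p.toRam q.toRam
  | ite b p q => .ite b p.toRam q.toRam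
  | forTo x b p => .seq (.assign x (.const 0))
      (.while (.lt (.var x) (.var b))
        (.seq p.toRam (.assign x (.add (.var x) (.const 1)))))

/-- The final memory as a function of the initial memory. -/
def run : LoopProg → RamState → RamState
  | skip, s => s
  | assign x e, s => s.setVar x (e.eval s)
  | store a i e, s => s.setArr a (i.eval s) (e.eval s)
  | seq p q, s => q.run (p.run s)
  | ite b p q, s => if b.eval s ≠ 0 then p.run s else q.run s
  | forTo x b p, s =>
      Nat.rec (s.setVar x 0) (fun i st => (p.run st).setVar x (i + 1)) (s.var b)

/-- The variables that a program assigns to. -/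
def vars : LoopProg → List ℕ
  | skip => []
  | assign x _ => [x]
  | store _ _ _ => []
  | seq p q => p.vars ++ q.vars
  | ite _ p q => p.vars ++ q.vars
  | forTo x _ p => x :: p.vars

/-- The arrays that a program writes to. -/
def arrs : LoopProg → List ℕ
  | skip => []
  | assign _ _ => []
  | store a _ _ => [a]
  | seq p q => p.arrs ++ q.arrs
  | ite _ p q => p.arrs ++ q.arrs
  | forTo _ _ p => p.arrs

/-- Every loop is bounded by variable `0` or variable `1`, these two variables are never changed,
and loop variables are not changed within the loop. -/
def IsBounded : LoopProg → Prop
  | skip => True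
  | assign x _ => x ≠ 0 ∧ x ≠ 1
  | store _ _ _ => True
  | seq p q => p.IsBounded ∧ q.IsBounded
  | ite _ p q => p.IsBounded ∧ q.IsBounded
  | forTo x b p => x ≠ 0 ∧ x ≠ 1 ∧ (b = 0 ∨ b = 1) ∧ x ∉ p.vars ∧ p.IsBounded

/-- A bound on the number of steps, as a polynomial in a bound on the variables `0` and `1`. -/
noncomputable def steps : LoopProg → Polynomial ℕ
  | skip => 1
  | assign _ e => .C (e.cost + 1)
  | store _ i e => .C (i.cost + e.cost + 1)
  | seq p q => p.steps + q.steps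
  | ite b p q => p.steps + q.steps + .C (b.cost + 1)
  | forTo _ _ p => .X * (p.steps + 8) + 6

theorem run_var {p : LoopProg} {y : ℕ} (hy : y ∉ p.vars) (s : RamState) :
    (p.run s).var y = s.var y := by
  induction p generalizing s with
  | skip => rfl
  | assign x e =>
    simp only [vars, List.mem_singleton] at hy
    simp [run, RamState.setVar, hy]
  | store a i e => rfl
  | seq p q ihp ihq =>
    simp only [vars, List.mem_append, not_or] at hy
    rw [run, ihq hy.2, ihp hy.1]
  | ite b p q ihp ihq =>
    simp only [vars, List.mem_append, not_or] at hy
    rw [run]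
    split
    · exact ihp hy.1 s
    · exact ihq hy.2 s
  | forTo x b p ih =>
    simp only [vars, List.mem_cons, not_or] at hy
    rw [run]
    induction s.var b with
    | zero => simp [RamState.setVar, hy.1]
    | succ i ihi => simpa [RamState.setVar, hy.1, ih hy.2] using ihi

theorem run_arr {p : LoopProg} {a : ℕ} (ha : a ∉ p.arrs) (s : RamState) :
    (p.run s).arr a = s.arr a := by
  induction p generalizing s with
  | skip => rfl
  | assign x e => rfl
  | store a i e =>
    simp only [arrs, List.mem_singleton] at ha
    simp [run, RamState.setArr, ha]
  | seq p q ihp ihq =>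
    simp only [arrs, List.mem_append, not_or] at ha
    rw [run, ihq ha.2, ihp ha.1]
  | ite b p q ihp ihq =>
    simp only [arrs, List.mem_append, not_or] at ha
    rw [run]
    split
    · exact ihp ha.1 s
    · exact ihq ha.2 s
  | forTo x b p ih =>
    rw [run]
    induction s.var b with
    | zero => rfl
    | succ i ihi =>
      rw [← ihi]
      exact ih ha _

/-- The invariant rule for loops. -/
theorem run_forTo {x b : ℕ} {p : LoopProg} {s : RamState} (I : ℕ → RamState → Prop)
    (h0 : I 0 (s.setVar x 0))
    (hstep : ∀ i st, i < s.var b → st.var x = i →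
      (∀ y, y ≠ x → y ∉ p.vars → st.var y = s.var y) → (∀ a, a ∉ p.arrs → st.arr a = s.arr a) →
      I i st → I (i + 1) ((p.run st).setVar x (i + 1))) :
    I (s.var b) ((forTo x b p).run s) := by
  suffices h : ∀ k ≤ s.var b, ∀ st : RamState,
      st = Nat.rec (s.setVar x 0) (fun i st => (p.run st).setVar x (i + 1)) k →
      st.var x = k ∧ (∀ y, y ≠ x → y ∉ p.vars → st.var y = s.var y) ∧
        (∀ a, a ∉ p.arrs → st.arr a = s.arr a) ∧ I k st from
    (h _ le_rfl _ rfl).2.2.2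
  intro k
  induction k with
  | zero =>
    rintro - st rfl
    refine ⟨by simp [RamState.setVar], fun y hy _ => by simp [RamState.setVar, hy],
      fun a _ => rfl, h0⟩
  | succ k ih =>
    rintro hk st rfl
    obtain ⟨h1, h2, h3, h4⟩ := ih (by omega) _ rfl
    refine ⟨by simp [RamState.setVar], fun y hy hyp => ?_, fun a ha => ?_,
      hstep k _ (by omega) h1 h2 h3 h4⟩
    · refine Eq.trans ?_ ((run_var hyp _).trans (h2 y hy hyp))
      simp [RamState.setVar, hy]
    · exact (run_arr ha _).trans (h3 a ha)

/-- A loop program runs in polynomial time. -/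
theorem exists_ramExec (p : LoopProg) (hp : p.IsBounded) {N : ℕ} (s : RamState)
    (h0 : s.var 0 ≤ N) (h1 : s.var 1 ≤ N) :
    ∃ t ≤ p.steps.eval N, RamExec p.toRam s (p.run s) t := by
  have hvars : ∀ {p : LoopProg}, p.IsBounded → 0 ∉ p.vars ∧ 1 ∉ p.vars := by
    intro p hp
    induction p with
    | skip => simp [vars]
    | assign x e => exact ⟨by simpa [vars] using hp.1.symm, by simpa [vars] using hp.2.symm⟩
    | store a i e => simp [vars]
    | seq p q ihp ihq => simp [vars, ihp hp.1, ihq hp.2]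
    | ite b p q ihp ihq => simp [vars, ihp hp.1, ihq hp.2]
    | forTo x b p ih => simp [vars, ih hp.2.2.2.2, hp.1.symm, hp.2.1.symm]
  induction p generalizing s with
  | skip => exact ⟨1, by simp [steps], .skip s⟩
  | assign x e => exact ⟨_, by simp [steps], .assign x e s⟩
  | store a i e => exact ⟨_, by simp [steps], .store a i e s⟩
  | seq p q ihp ihq =>
    obtain ⟨t, ht, hr⟩ := ihp hp.1 s h0 h1
    have hv := hvars hp.1
    obtain ⟨t', ht', hr'⟩ := ihq hp.2 (p.run s) (by rwa [run_var hv.1]) (by rwa [run_var hv.2])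
    exact ⟨t + t', by rw [steps, Polynomial.eval_add]; omega, .seq hr hr'⟩
  | ite b p q ihp ihq =>
    have hev : (ite b p q).steps.eval N = p.steps.eval N + q.steps.eval N + (b.cost + 1) := by
      simp [steps]
    rw [hev, run]
    split
    case isTrue hb =>
      obtain ⟨t, ht, hr⟩ := ihp hp.1 s h0 h1
      exact ⟨_, by omega, .ite_true hb hr⟩
    case isFalse hb =>
      obtain ⟨t, ht, hr⟩ := ihq hp.2 s h0 h1
      exact ⟨_, by omega, .ite_false (not_not.1 hb) hr⟩
  | forTo x b p ih =>
    obtain ⟨hx0, hx1, hb, hxp, hp'⟩ := hp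
    have hv := hvars hp'
    have hbx : b ≠ x := by
      rcases hb with rfl | rfl
      · exact hx0.symm
      · exact hx1.symm
    have hbp : b ∉ p.vars := by
      rcases hb with rfl | rfl
      · exact hv.1
      · exact hv.2
    have hbN : s.var b ≤ N := by
      rcases hb with rfl | rfl
      · exact h0
      · exact h1
    set R : ℕ → RamState :=
      fun k => Nat.rec (s.setVar x 0) (fun i st => (p.run st).setVar x (i + 1)) k with hR
    have hRx : ∀ k, (R k).var x = k := by
      intro k
      cases k <;> simp [hR, RamState.setVar]
    have hRy : ∀ k y, y ≠ x → y ∉ p.vars → (R k).var y = s.var y := by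
      intro k y hy hyp
      induction k with
      | zero => simp [hR, RamState.setVar, hy]
      | succ k ihk =>
        rw [← ihk, ← run_var hyp (R k)]
        simp [hR, RamState.setVar, hy]
    -- The remaining `d` rounds of the loop.
    have hloop : ∀ d, ∀ k, k + d = s.var b →
        ∃ t ≤ d * (p.steps.eval N + 8) + 4,
          RamExec (.while (.lt (.var x) (.var b))
            (.seq p.toRam (.assign x (.add (.var x) (.const 1))))) (R k) (R (s.var b)) t := by
      intro d
      induction d with
      | zero =>
        intro k hk
        rw [Nat.add_zero] at hk
        subst hk
        refine ⟨4, by omega, .while_false ?_⟩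
        simp [RamExpr.eval, hRx, hRy _ b hbx hbp]
      | succ d ihd =>
        intro k hk
        obtain ⟨t, ht, hr⟩ := ih hp' (R k) (by rwa [hRy k 0 hx0.symm hv.1])
          (by rwa [hRy k 1 hx1.symm hv.2])
        obtain ⟨t', ht', hr'⟩ := ihd (k + 1) (by omega)
        have hassign := RamExec.assign x (.add (.var x) (.const 1)) (p.run (R k))
        have hval : (p.run (R k)).setVar x
            ((RamExpr.add (.var x) (.const 1)).eval (p.run (R k))) = R (k + 1) := by
          simp only [RamExpr.eval, run_var hxp, hRx]
          rfl
        rw [hval] at hassign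
        refine ⟨_, ?_, .while_true ?_ (.seq hr hassign) hr'⟩
        · simp only [RamExpr.cost]
          rw [Nat.succ_mul]
          omega
        · simp only [RamExpr.eval, hRx, hRy _ b hbx hbp]
          rw [if_pos (by omega)]
          exact one_ne_zero
    obtain ⟨t, ht, hr⟩ := hloop (s.var b) 0 (by omega)
    refine ⟨_, ?_, .seq (.assign x (.const 0) s) hr⟩
    have hev : (forTo x b p).steps.eval N = N * (p.steps.eval N + 8) + 6 := by
      simp [steps]
    have := Nat.mul_le_mul_right (p.steps.eval N + 8) hbN
    simp only [RamExpr.cost]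
    omega

end LoopProg

/-! ### The program: connectivity after deletion of two edges -/

namespace LoopProg

/-- Processing edge number `var 8`, unless it is one of the edges number `var 5` and `var 6`: if one
end is marked in array `3`, mark both. -/
def relaxEdge : LoopProg :=
  .ite (.eq (.var 8) (.var 6)) .skip <|
    .ite (.eq (.var 8) (.var 5)) .skip <|
      .ite (.add (.arr 3 (.arr 0 (.var 8))) (.arr 3 (.arr 1 (.var 8))))
        (.seq (.store 3 (.arr 0 (.var 8)) (.const 1)) (.store 3 (.arr 1 (.var 8)) (.const 1)))
        .skip

/-- Mark, in array `3`, the vertices that can be reached from the first end of edge number `var 5`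
without the edges number `var 5` and `var 6`. -/
def markReachable : LoopProg :=
  .seq (.forTo 7 0 (.store 3 (.var 7) (.const 0))) <|
    .seq (.store 3 (.arr 0 (.var 5)) (.const 1)) <|
      .forTo 7 0 (.forTo 8 1 relaxEdge)

end LoopProg

/-- The memory holds the numbers of vertices and edges and the list of edges. -/
structure HasInput {n m : ℕ} (u v : Fin m → Fin n) (s : RamState) : Prop where
  var_zero : s.var 0 = n
  var_one : s.var 1 = m
  fst : ∀ j : Fin m, s.arr 0 j = u j
  snd : ∀ j : Fin m, s.arr 1 j = v j

section

open LoopProg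

variable {n m : ℕ} {u v : Fin m → Fin n}

theorem HasInput.congr {s s' : RamState} (h : HasInput u v s) (h0 : s'.var 0 = s.var 0)
    (h1 : s'.var 1 = s.var 1) (ha0 : s'.arr 0 = s.arr 0) (ha1 : s'.arr 1 = s.arr 1) :
    HasInput u v s' :=
  ⟨h0.trans h.var_zero, h1.trans h.var_one, fun j => by rw [ha0, h.fst], fun j => by
    rw [ha1, h.snd]⟩

theorem relaxEdge_spec {s : RamState} (hs : HasInput u v s) {e f j : Fin m}
    (h5 : s.var 5 = f) (h6 : s.var 6 = e) (h8 : s.var 8 = j) (x : ℕ) :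
    (relaxEdge.run s).arr 3 x ≠ 0 ↔ s.arr 3 x ≠ 0 ∨
      (j ≠ e ∧ j ≠ f ∧ (s.arr 3 (u j) ≠ 0 ∨ s.arr 3 (v j) ≠ 0) ∧ (x = u j ∨ x = v j)) := by
  have hne : ∀ {a b : Fin m}, ((a : ℕ) = b) ↔ a = b := Fin.val_inj
  simp only [relaxEdge, run, RamExpr.eval, h5, h6, h8, hs.fst, hs.snd, hne]
  by_cases hje : j = e
  · simp [hje]
  by_cases hjf : j = f
  · simp [hjf]
  by_cases h : s.arr 3 (u j) + s.arr 3 (v j) = 0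
  · have h1 : s.arr 3 (u j) = 0 := by omega
    have h2 : s.arr 3 (v j) = 0 := by omega
    simp [hje, hjf, h1, h2]
  · have h' : s.arr 3 (u j) ≠ 0 ∨ s.arr 3 (v j) ≠ 0 := by omega
    simp only [hje, hjf, h, h', if_false, ne_eq, not_true, not_false_iff, if_true, true_and]
    by_cases hxv : x = v j
    · simp [RamState.setArr, hxv, hs.snd, h8]
    · by_cases hxu : x = u j
      · simp [RamState.setArr, hxu, hs.snd, h8, Function.update_apply]
      · simp [RamState.setArr, hxu, hxv, hs.snd, h8]

/-- One round of label propagation keeps all marks, marks only what is connected to something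
marked, and marks all neighbours of marked vertices. -/
theorem forTo_relaxEdge_spec {H : SimpleGraph (Fin n)} {s : RamState} (hs : HasInput u v s)
    {e f : Fin m} (h5 : s.var 5 = f) (h6 : s.var 6 = e)
    (hH : ∀ x y, H.Adj x y ↔ ∃ j, j ≠ e ∧ j ≠ f ∧ s(u j, v j) = s(x, y)) (w : Fin n)
    (hsound : ∀ x : Fin n, s.arr 3 x ≠ 0 → H.Reachable w x) :
    (∀ x : Fin n, ((forTo 8 1 relaxEdge).run s).arr 3 x ≠ 0 → H.Reachable w x) ∧
    (∀ x : Fin n, s.arr 3 x ≠ 0 → ((forTo 8 1 relaxEdge).run s).arr 3 x ≠ 0) ∧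
    (∀ x y : Fin n, H.Adj x y → s.arr 3 x ≠ 0 →
      ((forTo 8 1 relaxEdge).run s).arr 3 y ≠ 0) := by
  have hadj : ∀ j, j ≠ e → j ≠ f → H.Adj (u j) (v j) := fun j hje hjf =>
    (hH _ _).2 ⟨j, hje, hjf, rfl⟩
  obtain ⟨h1, h2, h3⟩ := run_forTo (x := 8) (b := 1) (p := relaxEdge) (s := s)
    (fun i st => (∀ x : Fin n, st.arr 3 x ≠ 0 → H.Reachable w x) ∧
      (∀ x : Fin n, s.arr 3 x ≠ 0 → st.arr 3 x ≠ 0) ∧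
      (∀ j : Fin m, (j : ℕ) < i → j ≠ e → j ≠ f →
        (s.arr 3 (u j) ≠ 0 ∨ s.arr 3 (v j) ≠ 0) → st.arr 3 (u j) ≠ 0 ∧ st.arr 3 (v j) ≠ 0))
    ⟨hsound, fun x hx => hx, fun j hj => absurd hj (Nat.not_lt_zero _)⟩ (by
      intro i st hi hst8 hvar harr hI
      obtain ⟨hI1, hI2, hI3⟩ := hI
      rw [hs.var_one] at hi
      have hin : HasInput u v st := hs.congr (hvar 0 (by decide) (by decide))
        (hvar 1 (by decide) (by decide)) (harr 0 (by decide)) (harr 1 (by decide))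
      have hspec := relaxEdge_spec hin (j := ⟨i, hi⟩)
        ((hvar 5 (by decide) (by decide)).trans h5) ((hvar 6 (by decide) (by decide)).trans h6)
        hst8
      have hkeep : ∀ x : ℕ, st.arr 3 x ≠ 0 → (relaxEdge.run st).arr 3 x ≠ 0 :=
        fun x hx => (hspec x).2 (Or.inl hx)
      refine ⟨fun x hx => ?_, fun x hx => hkeep x (hI2 x hx), fun j hj hje hjf hjs => ?_⟩
      · rcases (hspec x).1 hx with hx | ⟨hie, hif, hor, hx⟩
        · exact hI1 x hx
        · have ha := hadj _ hie hif
          simp only [Fin.val_inj] at hx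
          rcases hor with h | h <;> rcases hx with rfl | rfl
          · exact hI1 _ h
          · exact (hI1 _ h).trans ha.reachable
          · exact (hI1 _ h).trans ha.symm.reachable
          · exact hI1 _ h
      · rcases Nat.lt_succ_iff_lt_or_eq.1 hj with hj | hj
        · exact ⟨hkeep _ (hI3 j hj hje hjf hjs).1, hkeep _ (hI3 j hj hje hjf hjs).2⟩
        · have hj' : j = ⟨i, hi⟩ := Fin.ext hj
          subst hj'
          have hor : st.arr 3 (u ⟨i, hi⟩) ≠ 0 ∨ st.arr 3 (v ⟨i, hi⟩) ≠ 0 :=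
            hjs.imp (hI2 _) (hI2 _)
          exact ⟨(hspec _).2 (Or.inr ⟨hje, hjf, hor, Or.inl rfl⟩),
            (hspec _).2 (Or.inr ⟨hje, hjf, hor, Or.inr rfl⟩)⟩)
  refine ⟨h1, h2, fun x y hxy hx => ?_⟩
  obtain ⟨j, hje, hjf, hj⟩ := (hH x y).1 hxy
  rw [hs.var_one] at h3
  rcases Sym2.eq_iff.1 hj with ⟨rfl, rfl⟩ | ⟨rfl, rfl⟩
  · exact (h3 j j.2 hje hjf (Or.inl hx)).2
  · exact (h3 j j.2 hje hjf (Or.inr hx)).1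

theorem markReachable_spec {H : SimpleGraph (Fin n)} {s : RamState} (hs : HasInput u v s)
    {e f : Fin m} (h5 : s.var 5 = f) (h6 : s.var 6 = e)
    (hH : ∀ x y, H.Adj x y ↔ ∃ j, j ≠ e ∧ j ≠ f ∧ s(u j, v j) = s(x, y)) (x : Fin n) :
    (markReachable.run s).arr 3 x ≠ 0 ↔ H.Reachable (u f) x := by
  set s₁ := (forTo 7 0 (.store 3 (.var 7) (.const 0))).run s with hs₁
  have hzero : ∀ y : Fin n, s₁.arr 3 y = 0 := by
    have := run_forTo (x := 7) (b := 0) (p := .store 3 (.var 7) (.const 0)) (s := s)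
      (fun i st => ∀ y < i, st.arr 3 y = 0) (fun y hy => absurd hy (Nat.not_lt_zero _))
      (by
        intro i st _ hst _ _ hI y hy
        simp only [run, RamExpr.eval, RamState.setVar, RamState.setArr, hst,
          Function.update_self, Function.update_apply]
        split
        · rfl
        · exact hI y (by omega))
    intro y
    exact this y (by rw [hs.var_zero]; exact y.2)
  have hin₁ : HasInput u v s₁ := hs.congr (run_var (by decide) s) (run_var (by decide) s)
    (run_arr (by decide) s) (run_arr (by decide) s)
  have h5₁ : s₁.var 5 = f := (run_var (by decide) s).trans h5
  have h6₁ : s₁.var 6 = e := (run_var (by decide) s).trans h6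
  set s₂ := s₁.setArr 3 (u f) 1 with hs₂
  have hin₂ : HasInput u v s₂ := hin₁.congr rfl rfl rfl rfl
  have hstart : ∀ y : Fin n, s₂.arr 3 y ≠ 0 ↔ y = u f := by
    intro y
    simp [hs₂, RamState.setArr, Function.update_apply, hzero, Fin.val_inj]
  have hrun : markReachable.run s = (forTo 7 0 (.forTo 8 1 relaxEdge)).run s₂ := by
    have h : s₂ = (LoopProg.store 3 (.arr 0 (.var 5)) (.const 1)).run s₁ := by
      simp only [run, RamExpr.eval, h5₁, hin₁.fst, hs₂]
    rw [h]
    rfl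
  rw [hrun]
  obtain ⟨h1, h2⟩ := run_forTo (x := 7) (b := 0) (p := .forTo 8 1 relaxEdge) (s := s₂)
    (fun i st => (∀ y : Fin n, st.arr 3 y ≠ 0 → H.Reachable (u f) y) ∧
      ∀ (y : Fin n) (p : H.Walk y (u f)), p.length ≤ i → st.arr 3 y ≠ 0)
    ⟨fun y hy => by rw [(hstart y).1 hy], fun y p hp =>
      (hstart y).2 (SimpleGraph.Walk.eq_of_length_eq_zero (Nat.le_zero.1 hp))⟩ (by
      intro i st _ _ hvar harr hI
      have hin : HasInput u v st := hin₂.congr (hvar 0 (by decide) (by decide))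
        (hvar 1 (by decide) (by decide)) (harr 0 (by decide)) (harr 1 (by decide))
      obtain ⟨hr1, hr2, hr3⟩ := forTo_relaxEdge_spec hin
        ((hvar 5 (by decide) (by decide)).trans h5₁) ((hvar 6 (by decide) (by decide)).trans h6₁)
        hH (u f) hI.1
      refine ⟨hr1, fun y p hp => ?_⟩
      cases p with
      | nil => exact hr2 _ (hI.2 _ .nil (Nat.zero_le _))
      | cons hyz q =>
        exact hr3 _ _ hyz.symm (hI.2 _ q (by simpa using hp)))
  refine ⟨h1 x, fun hx => ?_⟩
  obtain ⟨p, hp⟩ := hx.symm.exists_isPath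
  refine h2 x p ?_
  have := hp.length_lt
  rw [Fintype.card_fin] at this
  rw [hin₂.var_zero]
  exact this.le

end

/-! ### The program: sort keys, positions and cost -/

namespace LoopProg

/-- If the ends of edge number `f = var 5` are separated by deletion of this edge and of edge number
`e = var 6`, count this in cell `f` of array `4` and update the maximum in cell `f` of array `5`. -/
def recordPair : LoopProg :=
  .seq markReachable <|
    .ite (.arr 3 (.arr 1 (.var 5))) .skip <|
      .seq (.store 4 (.var 5) (.add (.arr 4 (.var 5)) (.const 1)))
        (.ite (.lt (.arr 5 (.var 5)) (.var 6)) (.store 5 (.var 5) (.var 6)) .skip)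

/-- Compute the sort keys of all edges in arrays `4` and `5`. -/
def computeKeys : LoopProg :=
  .forTo 5 1 <|
    .seq (.store 4 (.var 5) (.const 0)) <|
      .seq (.store 5 (.var 5) (.var 5)) <|
        .forTo 6 1 recordPair

/-- Nonzero if edge number `var 9` precedes edge number `var 5`, in the lexicographic order of the
cells of array `4`, the cells of array `5` and the numbers of the edges. -/
def keyLt : RamExpr :=
  .add (.lt (.arr 4 (.var 9)) (.arr 4 (.var 5))) <|
    .lt (.const 1) <| .add (.eq (.arr 4 (.var 9)) (.arr 4 (.var 5))) <|
      .lt (.const 0) <| .add (.lt (.arr 5 (.var 9)) (.arr 5 (.var 5))) <|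
        .lt (.const 1) <| .add (.eq (.arr 5 (.var 9)) (.arr 5 (.var 5))) <|
          .lt (.var 9) (.var 5)

/-- Compute the positions of all edges in array `2`. -/
def computePositions : LoopProg :=
  .forTo 5 1 <|
    .seq (.store 2 (.var 5) (.const 1)) <|
      .forTo 9 1 <|
        .ite keyLt (.store 2 (.var 5) (.add (.arr 2 (.var 5)) (.const 1))) .skip

/-- Compute the cost in variable `3`: an edge raises the rank unless it completes a cycle, which is
the case for the non-bridges that are the last ones of their cycles in the list of edges. -/
def computeCost : LoopProg :=
  .forTo 5 1 <|
    .ite (.lt (.const 1) (.add (.lt (.arr 4 (.var 5)) (.var 1)) (.eq (.arr 5 (.var 5)) (.var 5))))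
      .skip
      (.assign 3 (.add (.var 3) (.sub (.add (.var 1) (.const 1)) (.arr 2 (.var 5)))))

/-- The whole algorithm. -/
def solveMlop : LoopProg :=
  .seq computeKeys <| .seq computePositions <| .seq computeCost <|
    .ite (.lt (.var 2) (.var 3)) (.assign 4 (.const 0)) (.assign 4 (.const 1))

end LoopProg

section

open LoopProg

variable {n m : ℕ} {u v : Fin m → Fin n}

/-- The sum of the first `i` terms of a finite sequence. -/
def sumBelow (c : Fin m → ℕ) (i : ℕ) : ℕ :=
  ∑ e ∈ Finset.univ.filter (fun e : Fin m => (e : ℕ) < i), c e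

theorem sumBelow_succ (c : Fin m → ℕ) {i : ℕ} (hi : i < m) :
    sumBelow c (i + 1) = sumBelow c i + c ⟨i, hi⟩ := by
  have h : (Finset.univ.filter fun e : Fin m => (e : ℕ) < i + 1) =
      insert ⟨i, hi⟩ (Finset.univ.filter fun e : Fin m => (e : ℕ) < i) := by
    ext e
    simp only [Finset.mem_filter, Finset.mem_univ, true_and, Finset.mem_insert, Fin.ext_iff]
    omega
  rw [sumBelow, h, Finset.sum_insert (by simp), add_comm, sumBelow]

theorem sumBelow_self (c : Fin m → ℕ) : sumBelow c m = ∑ e, c e := by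
  rw [sumBelow, Finset.filter_true_of_mem fun e _ => e.2]

theorem sumBelow_zero (c : Fin m → ℕ) : sumBelow c 0 = 0 := by
  simp [sumBelow]

/-- The ends of edge number `f` are separated by deletion of the edges number `e` and `f`. -/
def Separates (G : SimpleGraph (Fin n)) (u v : Fin m → Fin n) (f e : Fin m) : Prop :=
  ¬ (G.deleteEdges {s(u e, v e), s(u f, v f)}).Reachable (u f) (v f)

open Classical in
theorem recordPair_spec {G : SimpleGraph (Fin n)} (hG : IsEdgeList G u v) {s : RamState}
    (hs : HasInput u v s) {e f : Fin m} (h5 : s.var 5 = f) (h6 : s.var 6 = e) :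
    (recordPair.run s).arr 4 = (if Separates G u v f e then
        Function.update (s.arr 4) f (s.arr 4 f + 1) else s.arr 4) ∧
      (recordPair.run s).arr 5 = (if Separates G u v f e ∧ s.arr 5 f < e then
        Function.update (s.arr 5) f e else s.arr 5) := by
  have hH : ∀ x y, (G.deleteEdges {s(u e, v e), s(u f, v f)}).Adj x y ↔
      ∃ j, j ≠ e ∧ j ≠ f ∧ s(u j, v j) = s(x, y) := by
    intro x y
    rw [SimpleGraph.deleteEdges_adj, ← SimpleGraph.mem_edgeSet, ← hG.2]
    constructor
    · rintro ⟨⟨j, hj⟩, hne⟩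
      simp only at hj
      rw [← hj] at hne
      refine ⟨j, ?_, ?_, hj⟩
      · rintro rfl
        exact hne (Or.inl rfl)
      · rintro rfl
        exact hne (Or.inr rfl)
    · rintro ⟨j, hje, hjf, hj⟩
      refine ⟨⟨j, hj⟩, ?_⟩
      rw [← hj]
      rintro (h | h)
      · exact hje (hG.1 h)
      · exact hjf (hG.1 h)
  have hmark := markReachable_spec hs h5 h6 hH (v f)
  set s₁ := markReachable.run s with hs₁
  have hin : HasInput u v s₁ := hs.congr (run_var (by decide) s) (run_var (by decide) s)
    (run_arr (by decide) s) (run_arr (by decide) s)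
  have h5₁ : s₁.var 5 = f := (run_var (by decide) s).trans h5
  have h6₁ : s₁.var 6 = e := (run_var (by decide) s).trans h6
  have ha4 : s₁.arr 4 = s.arr 4 := run_arr (by decide) s
  have ha5 : s₁.arr 5 = s.arr 5 := run_arr (by decide) s
  simp only [recordPair, run, ← hs₁, RamExpr.eval, h5₁, hin.snd, hmark, ha4]
  by_cases hr : (G.deleteEdges {s(u e, v e), s(u f, v f)}).Reachable (u f) (v f)
  · have hsep : ¬ Separates G u v f e := fun h => h hr
    simp [hr, hsep, ha4, ha5]
  · have hsep : Separates G u v f e := hr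
    by_cases hlt : s.arr 5 f < e
    · simp [hr, hsep, ha4, ha5, hlt, RamState.setArr, h5₁, h6₁]
    · simp [hr, hsep, ha4, ha5, hlt, RamState.setArr, h5₁, h6₁]

/-- The two sort keys of edge number `f`: how many edges `e` satisfy `Separates G u v f e`, and the
largest such `e`, or `f` if this is larger. -/
structure HasKeys (G : SimpleGraph (Fin n)) (u v : Fin m → Fin n) (s : RamState) (f : Fin m) :
    Prop where
  card : s.arr 4 f = {e | Separates G u v f e}.ncard
  isGreatest : IsGreatest {x : ℕ | x = f ∨ ∃ e : Fin m, Separates G u v f e ∧ x = e} (s.arr 5 f)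

theorem forTo_recordPair_spec {G : SimpleGraph (Fin n)} (hG : IsEdgeList G u v) {s : RamState}
    (hs : HasInput u v s) {f : Fin m} (h5 : s.var 5 = f) (h4f : s.arr 4 f = 0)
    (h5f : s.arr 5 f = f) :
    HasKeys G u v ((forTo 6 1 recordPair).run s) f ∧
      ∀ x : ℕ, x ≠ f → ((forTo 6 1 recordPair).run s).arr 4 x = s.arr 4 x ∧
        ((forTo 6 1 recordPair).run s).arr 5 x = s.arr 5 x := by
  classical
  obtain ⟨h1, h2, h3⟩ := run_forTo (x := 6) (b := 1) (p := recordPair) (s := s)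
    (fun i st => st.arr 4 f = sumBelow (fun e => if Separates G u v f e then 1 else 0) i ∧
      IsGreatest {x : ℕ | x = f ∨ ∃ e : Fin m, (e : ℕ) < i ∧ Separates G u v f e ∧ x = e}
        (st.arr 5 f) ∧
      ∀ x : ℕ, x ≠ f → st.arr 4 x = s.arr 4 x ∧ st.arr 5 x = s.arr 5 x)
    (by
      refine ⟨by simpa [RamState.setVar, sumBelow_zero] using h4f, ⟨Or.inl h5f, ?_⟩,
        fun x _ => ⟨rfl, rfl⟩⟩
      rintro x (rfl | ⟨e, he, -⟩)
      · exact h5f.ge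
      · exact absurd he (Nat.not_lt_zero _))
    (by
      intro i st hi hst6 hvar harr hI
      obtain ⟨hI1, ⟨hI2, hI3⟩, hI4⟩ := hI
      rw [hs.var_one] at hi
      have hin : HasInput u v st := hs.congr (hvar 0 (by decide) (by decide))
        (hvar 1 (by decide) (by decide)) (harr 0 (by decide)) (harr 1 (by decide))
      obtain ⟨hr4, hr5⟩ := recordPair_spec hG hin (e := ⟨i, hi⟩)
        ((hvar 5 (by decide) (by decide)).trans h5) hst6
      simp only [RamState.setVar]
      rw [hr4, hr5, sumBelow_succ _ hi, ← hI1]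
      refine ⟨?_, ⟨?_, ?_⟩, fun x hx => ?_⟩
      · by_cases hsep : Separates G u v f ⟨i, hi⟩ <;> simp [hsep]
      · by_cases hc : Separates G u v f ⟨i, hi⟩ ∧ st.arr 5 f < i
        · rw [if_pos hc, Function.update_self]
          exact Or.inr ⟨⟨i, hi⟩, Nat.lt_succ_self i, hc.1, rfl⟩
        · rw [if_neg hc]
          rcases hI2 with h | ⟨e, he, hse, hx⟩
          · exact Or.inl h
          · exact Or.inr ⟨e, Nat.lt_succ_of_lt he, hse, hx⟩
      · have hge : st.arr 5 f ≤ (if Separates G u v f ⟨i, hi⟩ ∧ st.arr 5 f < i then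
            Function.update (st.arr 5) f i else st.arr 5) f := by
          split
          next hc => rw [Function.update_self]; exact hc.2.le
          next hc => exact le_rfl
        rintro x (rfl | ⟨e, he, hse, rfl⟩)
        · exact (hI3 (Or.inl rfl)).trans hge
        · rcases Nat.lt_succ_iff_lt_or_eq.1 he with he | he
          · exact (hI3 (Or.inr ⟨e, he, hse, rfl⟩)).trans hge
          · have hee : e = ⟨i, hi⟩ := Fin.ext he
            subst hee
            by_cases hlt : st.arr 5 f < i
            · rw [if_pos ⟨hse, hlt⟩, Function.update_self]
            · exact (not_lt.1 hlt).trans hge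
      · rw [← (hI4 x hx).1, ← (hI4 x hx).2]
        constructor
        · split
          next => rw [Function.update_of_ne hx]
          next => rfl
        · split
          next => rw [Function.update_of_ne hx]
          next => rfl)
  rw [hs.var_one] at h1 h2
  refine ⟨⟨?_, ?_⟩, h3⟩
  · rw [h1, sumBelow_self, ← Finset.card_filter, ← Set.ncard_coe_finset]
    simp
  · simpa using h2

theorem computeKeys_spec {G : SimpleGraph (Fin n)} (hG : IsEdgeList G u v) {s : RamState}
    (hs : HasInput u v s) (f : Fin m) : HasKeys G u v (computeKeys.run s) f := by
  have h := run_forTo (x := 5) (b := 1) (s := s)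
    (p := .seq (.store 4 (.var 5) (.const 0)) <| .seq (.store 5 (.var 5) (.var 5)) <|
      .forTo 6 1 recordPair)
    (fun i st => ∀ f : Fin m, (f : ℕ) < i → HasKeys G u v st f)
    (fun f hf => absurd hf (Nat.not_lt_zero _))
    (by
      intro i st hi hst hvar harr hI f hf
      rw [hs.var_one] at hi
      set st₁ := (st.setArr 4 i 0).setArr 5 i i with hst₁
      have hrun : (LoopProg.seq (.store 4 (.var 5) (.const 0)) <|
          .seq (.store 5 (.var 5) (.var 5)) <| .forTo 6 1 recordPair).run st =
          (forTo 6 1 recordPair).run st₁ := by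
        have h : st₁ = (LoopProg.seq (.store 4 (.var 5) (.const 0))
            (.store 5 (.var 5) (.var 5))).run st := by
          simp [run, RamExpr.eval, hst, hst₁, RamState.setArr]
        rw [h]
        rfl
      have hin : HasInput u v st₁ := hs.congr (hvar 0 (by decide) (by decide))
        (hvar 1 (by decide) (by decide)) (harr 0 (by decide)) (harr 1 (by decide))
      obtain ⟨h1, h2⟩ := forTo_recordPair_spec hG hin (f := ⟨i, hi⟩) hst
        (by simp [hst₁, RamState.setArr]) (by simp [hst₁, RamState.setArr])
      rw [← hrun] at h1 h2
      rcases Nat.lt_succ_iff_lt_or_eq.1 hf with hf | hf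
      · have hne : (f : ℕ) ≠ i := by omega
        have hkeep := h2 f hne
        simp only [hst₁, RamState.setArr] at hkeep
        obtain ⟨hc, hg⟩ := hI f hf
        constructor
        · rw [← hc]
          exact hkeep.1.trans (by simp [hne])
        · refine Eq.mp (congrArg _ (Eq.symm ?_)) hg
          exact hkeep.2.trans (by simp [hne])
      · have hff : f = ⟨i, hi⟩ := Fin.ext hf
        subst hff
        exact ⟨h1.1, h1.2⟩)
  rw [hs.var_one] at h
  exact h f f.2

/-- The lexicographic sort key of edge number `f`. -/
def sortKey (s : RamState) (f : Fin m) : ℕ ×ₗ ℕ ×ₗ ℕ :=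
  toLex (s.arr 4 f, toLex (s.arr 5 f, (f : ℕ)))

theorem sortKey_lt_iff {s : RamState} {g f : Fin m} :
    sortKey s g < sortKey s f ↔ s.arr 4 g < s.arr 4 f ∨ s.arr 4 g = s.arr 4 f ∧
      (s.arr 5 g < s.arr 5 f ∨ s.arr 5 g = s.arr 5 f ∧ g < f) := by
  simp [sortKey, Prod.Lex.toLex_lt_toLex]

theorem sortKey_injective (s : RamState) : Function.Injective (sortKey (m := m) s) := by
  intro g f h
  have := congrArg (fun p => (ofLex (ofLex p).2).2) h
  exact Fin.ext this

theorem keyLt_spec {s : RamState} {g f : Fin m} (h9 : s.var 9 = g) (h5 : s.var 5 = f) :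
    keyLt.eval s ≠ 0 ↔ sortKey s g < sortKey s f := by
  rw [sortKey_lt_iff, Fin.lt_def]
  simp only [keyLt, RamExpr.eval, h9, h5]
  split_ifs <;> omega

theorem computePositions_spec {s : RamState} (hs : HasInput u v s) (f : Fin m) :
    (computePositions.run s).arr 2 f = 1 + {g : Fin m | sortKey s g < sortKey s f}.ncard := by
  classical
  have h := run_forTo (x := 5) (b := 1) (s := s)
    (p := .seq (.store 2 (.var 5) (.const 1)) <|
      .forTo 9 1 <|
        .ite keyLt (.store 2 (.var 5) (.add (.arr 2 (.var 5)) (.const 1))) .skip)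
    (fun i st => ∀ f : Fin m, (f : ℕ) < i →
      st.arr 2 f = 1 + {g : Fin m | sortKey s g < sortKey s f}.ncard)
    (fun f hf => absurd hf (Nat.not_lt_zero _))
    (by
      intro i st hi hst hvar harr hI f hf
      rw [hs.var_one] at hi
      set st₁ := st.setArr 2 i 1 with hst₁
      have hrun : (LoopProg.store 2 (.var 5) (.const 1)).run st = st₁ := by
        simp [run, RamExpr.eval, hst, hst₁]
      rw [run, hrun]
      have hst₁1 : st₁.var 1 = m := (hvar 1 (by decide) (by decide)).trans hs.var_one
      obtain ⟨h1, h2⟩ := run_forTo (x := 9) (b := 1) (s := st₁)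
        (p := .ite keyLt (.store 2 (.var 5) (.add (.arr 2 (.var 5)) (.const 1))) .skip)
        (fun k st' => st'.arr 2 i = 1 + sumBelow
            (fun g : Fin m => if sortKey s g < sortKey s ⟨i, hi⟩ then 1 else 0) k ∧
          ∀ x : ℕ, x ≠ i → st'.arr 2 x = st.arr 2 x)
        (by
          refine ⟨by simp [hst₁, RamState.setArr, RamState.setVar, sumBelow_zero], fun x hx => ?_⟩
          simp [hst₁, RamState.setArr, RamState.setVar, hx])
        (by
          intro k st' hk hst' hvar' harr' hI'
          rw [hst₁1] at hk
          have h5' : st'.var 5 = i := (hvar' 5 (by decide) (by decide)).trans hst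
          have hkeys : ∀ g : Fin m, sortKey st' g = sortKey s g := by
            intro g
            have h4 : st'.arr 4 = s.arr 4 := (harr' 4 (by decide)).trans (harr 4 (by decide))
            have h5 : st'.arr 5 = s.arr 5 := (harr' 5 (by decide)).trans (harr 5 (by decide))
            rw [sortKey, sortKey, h4, h5]
          have hlt := keyLt_spec (s := st') (g := ⟨k, hk⟩) (f := ⟨i, hi⟩) hst' h5'
          rw [hkeys, hkeys] at hlt
          rw [sumBelow_succ _ hk, ← add_assoc, ← hI'.1, run]
          simp only [hlt]
          by_cases hc : sortKey s ⟨k, hk⟩ < sortKey s ⟨i, hi⟩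
          · simp only [hc, if_true, run, RamExpr.eval, h5', RamState.setArr, RamState.setVar,
              Function.update_self, true_and]
            intro x hx
            rw [Function.update_of_ne hx]
            exact hI'.2 x hx
          · simp only [hc, if_false, run, RamState.setVar, add_zero, true_and]
            exact hI'.2)
      rw [hst₁1, sumBelow_self, ← Finset.card_filter, ← Set.ncard_coe_finset] at h1
      rcases Nat.lt_succ_iff_lt_or_eq.1 hf with hf | hf
      · exact (h2 f (by omega)).trans (hI f hf)
      · have hff : f = ⟨i, hi⟩ := Fin.ext hf
        subst hff
        refine h1.trans ?_
        simp)
  rw [hs.var_one] at h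
  exact h f f.2

theorem computeCost_spec {s : RamState} (hs : HasInput u v s) (h3 : s.var 3 = 0) :
    (computeCost.run s).var 3 =
      ∑ f : Fin m, if s.arr 4 f < m ∧ s.arr 5 f = f then 0 else m + 1 - s.arr 2 f := by
  have h := run_forTo (x := 5) (b := 1) (s := s)
    (p := .ite (.lt (.const 1)
        (.add (.lt (.arr 4 (.var 5)) (.var 1)) (.eq (.arr 5 (.var 5)) (.var 5)))) .skip
      (.assign 3 (.add (.var 3) (.sub (.add (.var 1) (.const 1)) (.arr 2 (.var 5))))))
    (fun i st => st.var 3 = sumBelow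
      (fun f : Fin m => if s.arr 4 f < m ∧ s.arr 5 f = f then 0 else m + 1 - s.arr 2 f) i)
    (by simpa [RamState.setVar, sumBelow_zero] using h3)
    (by
      intro i st hi hst hvar harr hI
      rw [hs.var_one] at hi
      have h1 : st.var 1 = m := (hvar 1 (by decide) (by decide)).trans hs.var_one
      have ha2 : st.arr 2 = s.arr 2 := harr 2 (by decide)
      have ha4 : st.arr 4 = s.arr 4 := harr 4 (by decide)
      have ha5 : st.arr 5 = s.arr 5 := harr 5 (by decide)
      rw [sumBelow_succ _ hi, ← hI]
      by_cases hc4 : s.arr 4 i < m <;> by_cases hc5 : s.arr 5 i = i <;>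
        simp [run, RamExpr.eval, hst, h1, ha2, ha4, ha5, hc4, hc5, RamState.setVar])
  rw [hs.var_one, sumBelow_self] at h
  exact h

end

/-! ### Correctness of the algorithm -/

section

open LoopProg

variable {n m : ℕ} {u v : Fin m → Fin n} {G : SimpleGraph (Fin n)} {s : RamState}

theorem IsEdgeList.mem_edgeSet (hE : IsEdgeList G u v) (f : Fin m) : s(u f, v f) ∈ G.edgeSet :=
  hE.2 ▸ Set.mem_range_self f

theorem IsEdgeList.exists_eq (hE : IsEdgeList G u v) {x : Sym2 (Fin n)} (hx : x ∈ G.edgeSet) :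
    ∃ f, s(u f, v f) = x := by
  rw [← hE.2] at hx
  exact hx

theorem IsEdgeList.ncard_setOf (hE : IsEdgeList G u v) {C : Set (Sym2 (Fin n))}
    (hC : C ⊆ G.edgeSet) : {f | s(u f, v f) ∈ C}.ncard = C.ncard := by
  rw [← hE.1.injOn.ncard_image]
  congr 1
  ext x
  constructor
  · rintro ⟨f, hf, rfl⟩
    exact hf
  · intro hx
    obtain ⟨f, rfl⟩ := hE.exists_eq (hC hx)
    exact ⟨f, hx, rfl⟩

theorem IsEdgeList.ncard_edgeSet (hE : IsEdgeList G u v) : G.edgeSet.ncard = m := by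
  rw [← hE.ncard_setOf subset_rfl,
    Set.eq_univ_of_forall (s := {f | s(u f, v f) ∈ G.edgeSet}) (fun f => hE.mem_edgeSet f),
    Set.ncard_univ, Nat.card_eq_fintype_card, Fintype.card_fin]

theorem separates_iff_of_mem (hG : IsCactus G) (hE : IsEdgeList G u v)
    {C : Set (Sym2 (Fin n))} (hC : (graphicMatroid G).IsCircuit C) {f : Fin m}
    (hf : s(u f, v f) ∈ C) (e : Fin m) : Separates G u v f e ↔ s(u e, v e) ∈ C ∧ e ≠ f := by
  rw [Separates, reachable_deleteEdges_pair_iff (hE.mem_edgeSet f)]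
  constructor
  · intro h
    by_contra hcon
    refine h ⟨C, hC, hf, fun he => ?_⟩
    by_contra hef
    exact hcon ⟨he, fun h' => hef (by rw [h'])⟩
  · rintro ⟨he, hef⟩ ⟨D, hD, hfD, heD⟩
    rw [← hG.hasDisjointCircuits.eq_of_mem hC hD hf hfD] at heD
    exact hef (hE.1 (heD he))

theorem separates_of_forall_notMem (hE : IsEdgeList G u v) {f : Fin m}
    (hf : ∀ C, (graphicMatroid G).IsCircuit C → s(u f, v f) ∉ C) (e : Fin m) :
    Separates G u v f e := by
  rw [Separates, reachable_deleteEdges_pair_iff (hE.mem_edgeSet f)]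
  rintro ⟨C, hC, hfC, -⟩
  exact hf C hC hfC

/-- On a cycle, the first key is the length minus one and the second key is the number of the last
edge of the cycle. -/
theorem HasKeys.of_mem {f : Fin m} (hs : HasKeys G u v s f) (hG : IsCactus G)
    (hE : IsEdgeList G u v) {C : Set (Sym2 (Fin n))} (hC : (graphicMatroid G).IsCircuit C)
    (hf : s(u f, v f) ∈ C) :
    s.arr 4 f + 1 = C.ncard ∧ ∃ r : Fin m, s.arr 5 f = r ∧ s(u r, v r) ∈ C ∧
      ∀ e : Fin m, s(u e, v e) ∈ C → e ≤ r := by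
  have hsep := separates_iff_of_mem hG hE hC hf
  constructor
  · rw [hs.card, ← hE.ncard_setOf hC.subset_ground]
    have h : {e | Separates G u v f e} = {e | s(u e, v e) ∈ C} \ {f} := by
      ext e
      exact hsep e
    rw [h]
    exact Set.ncard_sdiff_singleton_add_one hf
  · have hmax : ∀ e : Fin m, s(u e, v e) ∈ C → (e : ℕ) ≤ s.arr 5 f := by
      intro e he
      by_cases hef : e = f
      · exact hs.isGreatest.2 (Or.inl (congrArg _ hef))
      · exact hs.isGreatest.2 (Or.inr ⟨e, (hsep e).2 ⟨he, hef⟩, rfl⟩)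
    rcases hs.isGreatest.1 with h | ⟨r, hr, h⟩
    · exact ⟨f, h, hf, fun e he => Fin.le_def.2 ((hmax e he).trans_eq h)⟩
    · exact ⟨r, h, ((hsep r).1 hr).1, fun e he => Fin.le_def.2 ((hmax e he).trans_eq h)⟩

theorem HasKeys.of_forall_notMem {f : Fin m} (hs : HasKeys G u v s f) (hE : IsEdgeList G u v)
    (hf : ∀ C, (graphicMatroid G).IsCircuit C → s(u f, v f) ∉ C) : s.arr 4 f = m := by
  rw [hs.card, Set.eq_univ_of_forall (s := {e | Separates G u v f e})
    (fun e => separates_of_forall_notMem hE hf e),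
    Set.ncard_univ, Nat.card_eq_fintype_card, Fintype.card_fin]

/-- The ordering of the edges by their sort keys. -/
theorem exists_isOrdering_sortKey (hE : IsEdgeList G u v) (s : RamState) :
    ∃ σ : Sym2 (Fin n) → ℕ, IsOrdering G.edgeSet σ ∧
      (∀ f : Fin m, σ s(u f, v f) = 1 + {g : Fin m | sortKey s g < sortKey s f}.ncard) ∧
      ∀ g f : Fin m, σ s(u g, v g) < σ s(u f, v f) ↔ sortKey s g < sortKey s f := by
  let key : Sym2 (Fin n) → ℕ ×ₗ ℕ ×ₗ ℕ :=
    Function.extend (fun f : Fin m => s(u f, v f)) (sortKey s) (fun _ => toLex (0, toLex (0, 0)))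
  have hkey : ∀ f : Fin m, key s(u f, v f) = sortKey s f := fun f => hE.1.extend_apply _ _ f
  have hinj : Set.InjOn key G.edgeSet := by
    intro x hx y hy hxy
    obtain ⟨f, rfl⟩ := hE.exists_eq hx
    obtain ⟨g, rfl⟩ := hE.exists_eq hy
    rw [hkey, hkey] at hxy
    rw [sortKey_injective s hxy]
  obtain ⟨hord, hlt⟩ := isOrdering_ncard_key_le hinj
  refine ⟨_, hord, fun f => ?_, fun g f => ?_⟩
  · have himg : {y ∈ G.edgeSet | key y ≤ key s(u f, v f)} =
        (fun f : Fin m => s(u f, v f)) '' (insert f {g : Fin m | sortKey s g < sortKey s f}) := by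
      ext x
      constructor
      · rintro ⟨hx, hle⟩
        obtain ⟨g, rfl⟩ := hE.exists_eq hx
        rw [hkey, hkey] at hle
        rcases hle.lt_or_eq with h | h
        · exact ⟨g, Or.inr h, rfl⟩
        · exact ⟨g, Or.inl (sortKey_injective s h), rfl⟩
      · rintro ⟨g, rfl | hg, rfl⟩
        · exact ⟨hE.mem_edgeSet g, le_rfl⟩
        · refine ⟨hE.mem_edgeSet g, ?_⟩
          rw [hkey, hkey]
          exact le_of_lt hg
    simp only [himg]
    rw [hE.1.injOn.ncard_image, Set.ncard_insert_of_notMem (by simp), add_comm]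
  · rw [← hkey, ← hkey]
    exact hlt _ (hE.mem_edgeSet g) _ (hE.mem_edgeSet f)

theorem isCircuitwise_of_sortKey (hG : IsCactus G) (hE : IsEdgeList G u v)
    (hs : ∀ f : Fin m, HasKeys G u v s f) {σ : Sym2 (Fin n) → ℕ} (hσ : IsOrdering G.edgeSet σ)
    (hlt : ∀ g f : Fin m, σ s(u g, v g) < σ s(u f, v f) ↔ sortKey s g < sortKey s f) :
    IsCircuitwise (graphicMatroid G) (graphicMatroid G).E σ := by
  -- If the common keys of the edges of `C` are smaller than those of the edges of `D`, then `C`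
  -- comes before `D`.
  have hpair : ∀ C D, (graphicMatroid G).IsCircuit C → (graphicMatroid G).IsCircuit D →
      ∀ f g : Fin m, s(u f, v f) ∈ C → s(u g, v g) ∈ D →
      (s.arr 4 f < s.arr 4 g ∨ s.arr 4 f = s.arr 4 g ∧ s.arr 5 f < s.arr 5 g) →
      (∀ x ∈ C, ∀ y ∈ D, σ x < σ y) ∧ C.ncard ≤ D.ncard := by
    intro C D hC hD f g hf hg h
    have hkeys : ∀ C, (graphicMatroid G).IsCircuit C → ∀ f g : Fin m, s(u f, v f) ∈ C →
        s(u g, v g) ∈ C → s.arr 4 f = s.arr 4 g ∧ s.arr 5 f = s.arr 5 g := by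
      intro C hC f g hf hg
      obtain ⟨h1, r, hr, hrC, hrmax⟩ := (hs f).of_mem hG hE hC hf
      obtain ⟨h1', r', hr', hrC', hrmax'⟩ := (hs g).of_mem hG hE hC hg
      refine ⟨by omega, ?_⟩
      rw [hr, hr', le_antisymm (hrmax' r hrC) (hrmax r' hrC')]
    constructor
    · intro x hx y hy
      obtain ⟨f', rfl⟩ := hE.exists_eq (hC.subset_ground hx)
      obtain ⟨g', rfl⟩ := hE.exists_eq (hD.subset_ground hy)
      have h1 := hkeys C hC f f' hf hx
      have h2 := hkeys D hD g g' hg hy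
      rw [hlt, sortKey_lt_iff]
      omega
    · have := ((hs f).of_mem hG hE hC hf).1
      have := ((hs g).of_mem hG hE hD hg).1
      omega
  refine ⟨hσ, fun C D hC hD hne => ?_, fun C hC x hx y hy hyD => ?_⟩
  · rw [Set.inter_eq_left.2 hC.subset_ground, Set.inter_eq_left.2 hD.subset_ground]
    obtain ⟨x, hx⟩ := hC.nonempty
    obtain ⟨y, hy⟩ := hD.nonempty
    obtain ⟨f, rfl⟩ := hE.exists_eq (hC.subset_ground hx)
    obtain ⟨g, rfl⟩ := hE.exists_eq (hD.subset_ground hy)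
    have hrep : s.arr 5 f ≠ s.arr 5 g := by
      obtain ⟨-, r, hr, hrC, -⟩ := (hs f).of_mem hG hE hC hx
      obtain ⟨-, r', hr', hrD, -⟩ := (hs g).of_mem hG hE hD hy
      rw [hr, hr']
      intro h
      rw [← Fin.ext h] at hrD
      exact hne (hG.hasDisjointCircuits.eq_of_mem hC hD hrC hrD)
    by_cases h : s.arr 4 f < s.arr 4 g ∨ s.arr 4 f = s.arr 4 g ∧ s.arr 5 f < s.arr 5 g
    · exact Or.inl (hpair C D hC hD f g hx hy h)
    · obtain ⟨h1, h2⟩ := hpair D C hD hC g f hy hx (by omega)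
      exact Or.inr ⟨fun a ha b hb => h1 b hb a ha, h2⟩
  · obtain ⟨f, rfl⟩ := hE.exists_eq (hC.subset_ground hx.1)
    obtain ⟨g, rfl⟩ := hE.exists_eq hy
    rw [hlt, sortKey_lt_iff]
    have h1 := ((hs f).of_mem hG hE hC hx.1).1
    have h2 := (hs g).of_forall_notMem hE hyD
    have h3 := Set.ncard_le_ncard hC.subset_ground
    rw [graphicMatroid_ground, hE.ncard_edgeSet] at h3
    omega

/-- The edges that the program skips are the last edges of the cycles, both in the list and in the
ordering, that is, the edges that do not raise the rank. -/
theorem mlopCost_eq_sum (hG : IsCactus G) (hE : IsEdgeList G u v)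
    (hs : ∀ f : Fin m, HasKeys G u v s f) {σ : Sym2 (Fin n) → ℕ} (hσ : IsOrdering G.edgeSet σ)
    (hlt : ∀ g f : Fin m, σ s(u g, v g) < σ s(u f, v f) ↔ sortKey s g < sortKey s f) :
    mlopCost (graphicMatroid G) σ = ∑ f : Fin m,
      if s.arr 4 f < m ∧ s.arr 5 f = f then 0 else m + 1 - σ s(u f, v f) := by
  classical
  have hcost := hG.hasDisjointCircuits.mlopCost_add hσ
  rw [graphicMatroid_ground, hE.ncard_edgeSet] at hcost
  have hall : ∑ f : Fin m, (m + 1 - σ s(u f, v f)) = ∑ i ∈ Finset.Icc 1 m, i := by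
    refine Finset.sum_bij (fun f _ => m + 1 - σ s(u f, v f)) ?_ ?_ ?_ fun _ _ => rfl
    · intro f _
      have h1 := hσ.one_le (hE.mem_edgeSet f)
      have h2 := hσ.le_ncard (hE.mem_edgeSet f)
      rw [hE.ncard_edgeSet] at h2
      rw [Finset.mem_Icc]
      omega
    · intro f _ g _ hfg
      have h2 := hσ.le_ncard (hE.mem_edgeSet f)
      have h2' := hσ.le_ncard (hE.mem_edgeSet g)
      rw [hE.ncard_edgeSet] at h2 h2'
      have hfg' : σ s(u f, v f) = σ s(u g, v g) := by
        omega
      exact hE.1 (hσ.injOn (hE.mem_edgeSet f) (hE.mem_edgeSet g) hfg')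
    · intro i hi
      rw [Finset.mem_Icc] at hi
      obtain ⟨x, hx, hxi⟩ := hσ.surjOn (show m + 1 - i ∈ Set.Icc 1 G.edgeSet.ncard by
        rw [hE.ncard_edgeSet, Set.mem_Icc]
        omega)
      obtain ⟨f, rfl⟩ := hE.exists_eq hx
      exact ⟨f, Finset.mem_univ f, by omega⟩
  have hclosing : ∑ f ∈ Finset.univ.filter (fun f : Fin m => s.arr 4 f < m ∧ s.arr 5 f = f),
      (m + 1 - σ s(u f, v f)) = ∑ C ∈ circuits (graphicMatroid G), (m + 1 - lastPos σ C) := by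
    have hmem : ∀ f : Fin m, s.arr 4 f < m →
        ∃ C, (graphicMatroid G).IsCircuit C ∧ s(u f, v f) ∈ C := by
      intro f hf
      by_contra hcon
      push Not at hcon
      exact hf.ne ((hs f).of_forall_notMem hE hcon)
    choose! c hc using hmem
    refine Finset.sum_bij (fun f _ => c f) ?_ ?_ ?_ ?_
    · intro f hf
      rw [Finset.mem_filter] at hf
      exact mem_circuits.2 (hc f hf.2.1).1
    · intro f hf g hg hfg
      rw [Finset.mem_filter] at hf hg
      obtain ⟨hC, hfC⟩ := hc f hf.2.1
      have hgC := (hc g hg.2.1).2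
      rw [← hfg] at hgC
      obtain ⟨-, r, hr, -, hmax⟩ := (hs f).of_mem hG hE hC hfC
      obtain ⟨-, r', hr', -, hmax'⟩ := (hs g).of_mem hG hE hC hgC
      have h1 : f = r := Fin.ext (hf.2.2.symm.trans hr)
      have h2 : g = r' := Fin.ext (hg.2.2.symm.trans hr')
      subst h1 h2
      exact le_antisymm (hmax' f hfC) (hmax g hgC)
    · intro C hC
      rw [mem_circuits] at hC
      obtain ⟨x, hx⟩ := hC.nonempty
      obtain ⟨g, rfl⟩ := hE.exists_eq (hC.subset_ground hx)
      obtain ⟨-, f, -, hf, hmax⟩ := (hs g).of_mem hG hE hC hx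
      obtain ⟨h1, r, hr, hrC, hmax'⟩ := (hs f).of_mem hG hE hC hf
      have hlen := Set.ncard_le_ncard hC.subset_ground
      rw [graphicMatroid_ground, hE.ncard_edgeSet] at hlen
      have hf4 : s.arr 4 f < m := by omega
      refine ⟨f, ?_, hG.hasDisjointCircuits.eq_of_mem (hc f hf4).1 hC (hc f hf4).2 hf⟩
      rw [Finset.mem_filter]
      refine ⟨Finset.mem_univ f, hf4, ?_⟩
      rw [hr, le_antisymm (hmax r hrC) (hmax' f hf)]
    · intro f hf
      rw [Finset.mem_filter] at hf
      obtain ⟨hC, hfC⟩ := hc f hf.2.1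
      -- The last edge of the cycle in the list is also its last edge in the ordering.
      suffices h : lastPos σ (c f) = σ s(u f, v f) by rw [h]
      refine le_antisymm (lastPos_le hC.nonempty fun x hx => ?_) (le_lastPos hfC)
      obtain ⟨g, rfl⟩ := hE.exists_eq (hC.subset_ground hx)
      obtain ⟨h1, r, hr, hrC, hmax⟩ := (hs f).of_mem hG hE hC hfC
      obtain ⟨h1', r', hr', hrC', hmax'⟩ := (hs g).of_mem hG hE hC hx
      have hrr : r' = r := le_antisymm (hmax r' hrC') (hmax' r hrC)
      subst hrr
      have hfr : f = r' := Fin.ext (hf.2.2.symm.trans hr)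
      have hgf := hmax g hx
      rw [← hfr] at hgf
      by_contra hcon
      rw [not_le, hlt, sortKey_lt_iff] at hcon
      omega
  have hsplit := Finset.sum_filter_add_sum_filter_not Finset.univ
    (fun f : Fin m => s.arr 4 f < m ∧ s.arr 5 f = f) (fun f => m + 1 - σ s(u f, v f))
  have hgoal : (∑ f : Fin m,
      if s.arr 4 f < m ∧ s.arr 5 f = f then 0 else m + 1 - σ s(u f, v f)) =
      ∑ f ∈ Finset.univ.filter (fun f : Fin m => ¬ (s.arr 4 f < m ∧ s.arr 5 f = f)),
        (m + 1 - σ s(u f, v f)) := by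
    rw [Finset.sum_filter]
    exact Finset.sum_congr rfl fun f _ => by rw [ite_not]
  rw [hgoal]
  omega

theorem hasInput_ramInput (u v : Fin m → Fin n) (k : ℕ) : HasInput u v (ramInput u v k) := by
  constructor <;> simp [ramInput]

theorem solveMlop_spec (hG : IsCactus G) (hE : IsEdgeList G u v) (k : ℕ) :
    SolvesMlop G u v k (solveMlop.run (ramInput u v k)) := by
  set s₀ := ramInput u v k with hs₀
  have hin₀ : HasInput u v s₀ := hasInput_ramInput u v k
  have hkeys := computeKeys_spec hE hin₀
  set s₁ := computeKeys.run s₀ with hs₁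
  have hin₁ : HasInput u v s₁ := hin₀.congr (run_var (by decide) _) (run_var (by decide) _)
    (run_arr (by decide) _) (run_arr (by decide) _)
  have hpos := computePositions_spec hin₁
  set s₂ := computePositions.run s₁ with hs₂
  have hin₂ : HasInput u v s₂ := hin₁.congr (run_var (by decide) _) (run_var (by decide) _)
    (run_arr (by decide) _) (run_arr (by decide) _)
  have h3 : s₂.var 3 = 0 := by
    rw [hs₂, run_var (by decide), hs₁, run_var (by decide)]
    simp [hs₀, ramInput]
  have hcost := computeCost_spec hin₂ h3
  set s₃ := computeCost.run s₂ with hs₃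
  have h2 : s₃.var 2 = k := by
    rw [hs₃, run_var (by decide), hs₂, run_var (by decide), hs₁, run_var (by decide)]
    simp [hs₀, ramInput]
  have h4 : s₂.arr 4 = s₁.arr 4 := run_arr (by decide) _
  have h5 : s₂.arr 5 = s₁.arr 5 := run_arr (by decide) _
  have h23 : s₃.arr 2 = s₂.arr 2 := run_arr (by decide) _
  obtain ⟨σ, hσ, hσpos, hσlt⟩ := exists_isOrdering_sortKey hE s₁
  have hopt := (isCircuitwise_of_sortKey hG hE hkeys hσ hσlt).isOptimalOrdering
    hG.hasDisjointCircuits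
  have hcost' : s₃.var 3 = mlopCost (graphicMatroid G) σ := by
    rw [hcost, mlopCost_eq_sum hG hE hkeys hσ hσlt]
    refine Finset.sum_congr rfl fun f _ => ?_
    rw [h4, h5, hpos, hσpos]
  have hiff : (∃ τ, IsOrdering (graphicMatroid G).E τ ∧ mlopCost (graphicMatroid G) τ ≤ k) ↔
      ¬ k < s₃.var 3 := by
    rw [hcost', not_lt]
    exact ⟨fun ⟨τ, hτ, hle⟩ => (hopt.2 τ hτ).trans hle, fun h => ⟨σ, hopt.1, h⟩⟩
  have hrun : solveMlop.run s₀ = s₃.setVar 4 (if k < s₃.var 3 then 0 else 1) := by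
    have h : solveMlop.run s₀ = (LoopProg.ite (.lt (.var 2) (.var 3)) (.assign 4 (.const 0))
        (.assign 4 (.const 1))).run s₃ := rfl
    rw [h]
    simp only [run, RamExpr.eval, h2]
    split_ifs <;> simp_all
  rw [hrun]
  refine ⟨⟨σ, hopt, fun f => ?_, ?_⟩, fun h => ?_, fun h => ?_⟩
  · rw [hσpos f, ← hpos f, ← h23]
    rfl
  · rw [← hcost']
    simp [RamState.setVar]
  · rw [hiff] at h
    simp [RamState.setVar, h]
  · rw [hiff, not_not] at h
    simp [RamState.setVar, h]

theorem isBounded_solveMlop : solveMlop.IsBounded := by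
  simp [solveMlop, computeKeys, computePositions, computeCost, recordPair, markReachable,
    relaxEdge, IsBounded, vars]

end

theorem mainTheorem7 :
    (∃ (P : RamProg) (q : Polynomial ℕ),
      ∀ (n m : ℕ) (G : SimpleGraph (Fin n)) (u v : Fin m → Fin n) (k : ℕ),
        IsCactus G → IsEdgeList G u v →
          ∃ (s' : RamState) (t : ℕ),
            RamExec P (ramInput u v k) s' t ∧ t ≤ q.eval (n + m) ∧ SolvesMlop G u v k s') ∧
    (∀ (V : Type*) [Finite V] (G : SimpleGraph V), IsCactus G →
      (∀ σ : Sym2 V → ℕ, IsOptimalOrdering (graphicMatroid G) σ →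
        ∀ e ∈ G.edgeSet, ∀ f ∈ G.edgeSet, ¬ G.IsBridge e → G.IsBridge f → σ e < σ f) ∧
      (∀ T : Set (Sym2 V), (graphicMatroid G).IsBase T →
        (∃ π : Sym2 V → ℕ, IsGreedyOrdering G T π) ∧
        (∀ π : Sym2 V → ℕ, IsGreedyOrdering G T π →
          (∀ (B : Set (Sym2 V)) (π' : Sym2 V → ℕ), (graphicMatroid G).IsBase B →
            IsOrdering B π' →
              basisCost (graphicMatroid G) T π ≤ basisCost (graphicMatroid G) B π') ∧
          (∃ σ : Sym2 V → ℕ, ExtendsBasisOrdering (graphicMatroid G) T π σ) ∧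
          (∀ σ : Sym2 V → ℕ, ExtendsBasisOrdering (graphicMatroid G) T π σ →
            IsOptimalOrdering (graphicMatroid G) σ)))) := by
  refine ⟨⟨LoopProg.solveMlop.toRam, LoopProg.solveMlop.steps, fun n m G u v k hG hE => ?_⟩,
    fun V _ G hG => ⟨fun σ hσ e he f hf heb hfb => hG.lt_of_isOptimalOrdering hσ he hf heb hfb,
      fun T hT => ⟨hG.exists_isGreedyOrdering hT, fun π hπ => ⟨fun B π' hB hπ' => ?_, ?_,
        fun σ hσ => ?_⟩⟩⟩⟩
  · have hin := hasInput_ramInput u v k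
    obtain ⟨t, ht, hrun⟩ := LoopProg.exists_ramExec LoopProg.solveMlop isBounded_solveMlop
      (N := n + m) (ramInput u v k) (by rw [hin.var_zero]; omega) (by rw [hin.var_one]; omega)
    exact ⟨_, t, hrun, ht, solveMlop_spec hG hE k⟩
  · exact (hπ.isCircuitwise hG hT).basisCost_le hG.hasDisjointCircuits hT hB hπ'
  · exact exists_extendsBasisOrdering _ hT.subset_ground hπ.isOrdering
  · exact (hσ.isCircuitwise hG.hasDisjointCircuits hT
      (hπ.isCircuitwise hG hT)).isOptimalOrdering hG.hasDisjointCircuits
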